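/- Let $n,k\ge 2$ and let $A_0,\dots,A_k$ be generic $n\times n$ matrices over $\mathbb{Q}$, i.e. the $(k+1)n^2$ entries of the $A_r$ are algebraically independent over $\mathbb{Q}$. Let $K$ be the field generated over $\mathbb{Q}$ by these entries, let $\overline{K}$ be an algebraic closure of $K$, and consider the equation $$A_kX^k+\cdots+A_1X+A_0=0_n\qquad (\ast)$$ in the unknown $X\in\mathcal{M}_n(\overline{K})$. Put $\phi(\lambda)=\det(\lambda^kA_k+\cdots+\lambda A_1+A_0)\in K[\lambda]$. A solution of $(\ast)$ is called simple if it has multiplicity $1$, where the multiplicity of $X_0$ is the dimension over $\overline{K}$ of the quotient of the local ring of the affine space $\overline{K}^{n^2}$ at $X_0$ by the ideal generated by the $n^2$ scalar equations of $(\ast)$. Then: (i) The equation $(\ast)$ has exactly $\binom{kn}{n}$ solutions in $\mathcal{M}_n(\overline{K})$, and all of them are simple. The polynomial $\phi$ has degree $kn$, it has $kn$ distinct roots $\lambda_1,\dots,\lambda_{kn}$ in $\overline{K}$, and its Galois group over $K$ is isomorphic to the symmetric group $S_{kn}$. For every choice of nonzero vectors $u_i\in\overline{K}^n$ with $(\lambda_i^kA_k+\cdots+\lambda_iA_1+A_0)u_i=0$,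 and for every $J=\{i_1<\cdots<i_n\}\subset\{1,\dots,kn\}$, the matrix $P_J=[u_{i_1},\dots,u_{i_n}]$ is invertible, and $J\mapsto X_J=P_J\,\mathrm{diag}(\lambda_{i_1},\dots,\lambda_{i_n})\,P_J^{-1}$ is a bijection from the set of $n$-element subsets of $\{1,\dots,kn\}$ onto the set of solutions of $(\ast)$. Moreover, $K(\lambda_1,\dots,\lambda_{kn})$ is the smallest field $L$ with $K\subset L\subset\overline{K}$ such that $\mathcal{M}_n(L)$ contains all solutions of $(\ast)$. (ii) The equation $(\ast)$ is solvable (it has a finite positive number of solutions, and the entries of every solution can be computed by radicals over $K$) if and only if $n=k=2$. (iii) The solvability complexity of $(\ast)$ is $\left(\binom{kn}{n},S_{kn}\right)$: the equation has exactly $\binom{kn}{n}$ solutions, and there is a nonzero polynomial over $K$ whose Galois group over $K$ is isomorphic to $S_{kn}$ and whose roots in $\overline{K}$ generate over $K$ the same field as the entries of all the solutions. -/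

import Mathlib

open Polynomial

noncomputable section

/-! ### Multiplicity of a point in a polynomial system -/

/-- The maximal ideal of `L[x_s : s ∈ σ]` consisting of the polynomials vanishing at `x`. -/
abbrev pointIdeal {σ L : Type*} [Field L] (x : σ → L) : Ideal (MvPolynomial σ L) :=
  RingHom.ker (MvPolynomial.eval x)

instance pointIdeal_isPrime {σ L : Type*} [Field L] (x : σ → L) : (pointIdeal x).IsPrime :=
  RingHom.ker_isPrime (MvPolynomial.eval x)

/-- The local ring of the affine space `L^σ` at the point `x`. -/
abbrev LocalRingAt {σ L : Type*} [Field L] (x : σ → L) : Type _ :=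
  Localization.AtPrime (pointIdeal x)

/-- The multiplicity of the point `x` in the polynomial system `f_i = 0`: the dimension over `L`
of the quotient of the local ring at `x` by the ideal generated by the `f_i`. -/
def systemMultiplicity {σ ι L : Type*} [Field L] (f : ι → MvPolynomial σ L) (x : σ → L) : ℕ :=
  Module.finrank L
    (LocalRingAt x ⧸
      (Ideal.span (Set.range f)).map (algebraMap (MvPolynomial σ L) (LocalRingAt x)))

/-! ### Generic matrices and the unilateral equation -/

/-- All the entries of the matrices `A_0, …, A_k`, as a single family. -/
def matrixEntries {n k : ℕ} {K : Type*} (A : Fin (k + 1) → Matrix (Fin n) (Fin n) K) :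
    Fin (k + 1) × Fin n × Fin n → K :=
  fun p => A p.1 p.2.1 p.2.2

/-- `A_0, …, A_k` are generic matrices over `ℚ`: their entries are mutually transcendental. -/
def AreGenericMatrices {n k : ℕ} {K : Type*} [Field K] [CharZero K]
    (A : Fin (k + 1) → Matrix (Fin n) (Fin n) K) : Prop :=
  AlgebraicIndependent ℚ (matrixEntries A)

/-- The value `A_k X^k + ⋯ + A_1 X + A_0`, computed in matrices over a `K`-algebra `R`. -/
def unilateral {n k : ℕ} {K : Type*} [Field K] (A : Fin (k + 1) → Matrix (Fin n) (Fin n) K)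
    {R : Type*} [CommRing R] [Algebra K R] (X : Matrix (Fin n) (Fin n) R) :
    Matrix (Fin n) (Fin n) R :=
  ∑ r : Fin (k + 1), (A r).map (algebraMap K R) * X ^ (r : ℕ)

/-- The solutions `X ∈ M_n(Ω)` of `A_k X^k + ⋯ + A_1 X + A_0 = 0`. -/
def unilateralSolutions {n k : ℕ} {K : Type*} [Field K]
    (A : Fin (k + 1) → Matrix (Fin n) (Fin n) K) (Ω : Type*) [Field Ω] [Algebra K Ω] :
    Set (Matrix (Fin n) (Fin n) Ω) :=
  {X | unilateral A X = 0}

/-- The `n²` scalar polynomials in the `n²` unknowns `x_{i,j}` which are the entries of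
`A_k X^k + ⋯ + A_1 X + A_0` for `X = [x_{i,j}]`. -/
def unilateralSystem {n k : ℕ} {K : Type*} [Field K]
    (A : Fin (k + 1) → Matrix (Fin n) (Fin n) K) (Ω : Type*) [Field Ω] [Algebra K Ω] :
    Fin n × Fin n → MvPolynomial (Fin n × Fin n) Ω :=
  fun p => unilateral A (Matrix.mvPolynomialX (Fin n) (Fin n) Ω) p.1 p.2

/-- `X` is a simple solution: a solution of multiplicity one. -/
def IsSimpleSolution {n k : ℕ} {K : Type*} [Field K]
    (A : Fin (k + 1) → Matrix (Fin n) (Fin n) K) {Ω : Type*} [Field Ω] [Algebra K Ω]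
    (X : Matrix (Fin n) (Fin n) Ω) : Prop :=
  X ∈ unilateralSolutions A Ω ∧
    systemMultiplicity (unilateralSystem A Ω) (fun p : Fin n × Fin n => X p.1 p.2) = 1

/-- The matrix pencil `μ^k A_k + ⋯ + μ A_1 + A_0`, for `μ` in a `K`-algebra `R`. -/
def matrixPencil {n k : ℕ} {K : Type*} [Field K] (A : Fin (k + 1) → Matrix (Fin n) (Fin n) K)
    {R : Type*} [CommRing R] [Algebra K R] (μ : R) : Matrix (Fin n) (Fin n) R :=
  ∑ r : Fin (k + 1), μ ^ (r : ℕ) • (A r).map (algebraMap K R)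

/-- The polynomial `φ(x) = det (x^k A_k + ⋯ + x A_1 + A_0) ∈ K[x]`. -/
def pencilDet {n k : ℕ} {K : Type*} [Field K] (A : Fin (k + 1) → Matrix (Fin n) (Fin n) K) :
    K[X] :=
  (matrixPencil A (Polynomial.X : K[X])).det

/-! ### The matrices built from eigenvalues and eigenvectors -/

/-- The matrix `P_J = [u_{i_1}, …, u_{i_n}]` whose columns are the selected vectors, for
`J = {i_1 < ⋯ < i_n}` given by its increasing enumeration. -/
def eigenvectorMatrix {n m : ℕ} {Ω : Type*} (u : Fin m → Fin n → Ω) (J : Fin n ↪o Fin m) :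
    Matrix (Fin n) (Fin n) Ω :=
  Matrix.of fun a b => u (J b) a

/-- The matrix `X_J = P_J diag(ev_{i_1}, …, ev_{i_n}) P_J⁻¹`. -/
def solutionOfSubset {n m : ℕ} {Ω : Type*} [Field Ω] (ev : Fin m → Ω) (u : Fin m → Fin n → Ω)
    (J : Fin n ↪o Fin m) : Matrix (Fin n) (Fin n) Ω :=
  eigenvectorMatrix u J * Matrix.diagonal (fun b => ev (J b)) * (eigenvectorMatrix u J)⁻¹

/-! ### Solvability and its complexity -/

/-- A matrix equation with solution set `S` is solvable (by radicals over `K`): it has a finite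
positive number of solutions, and all the entries of the solutions can be computed by radicals. -/
def IsSolvableEquation (K : Type*) {Ω : Type*} [Field K] [Field Ω] [Algebra K Ω] {n : ℕ}
    (S : Set (Matrix (Fin n) (Fin n) Ω)) : Prop :=
  S.Finite ∧ S.Nonempty ∧ ∀ X ∈ S, ∀ i j, X i j ∈ solvableByRad K Ω

/-- A matrix equation with solution set `S` has solvability complexity `(ν, G)`: it has exactly
`ν` solutions, and finding their entries is equivalent to finding the roots of a polynomial
over `K` with Galois group `G` (both generate the same extension of `K`). -/
def HasSolvabilityComplexity (K : Type*) {Ω : Type*} [Field K] [Field Ω] [Algebra K Ω] {n : ℕ}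
    (S : Set (Matrix (Fin n) (Fin n) Ω)) (ν : ℕ) (G : Type*) [Group G] : Prop :=
  S.Finite ∧ S.ncard = ν ∧
    ∃ p : K[X], p ≠ 0 ∧ (p.map (algebraMap K Ω)).Splits ∧
      IntermediateField.adjoin K {a : Ω | ∃ X ∈ S, ∃ i j, X i j = a} =
        IntermediateField.adjoin K (p.rootSet Ω) ∧
      Nonempty (p.Gal ≃* G)

end

/-! Write A(μ) for the pencil. Since a scalar μ commutes with X, one has A(μ) - A(X) = Q(μ)(μ - X)
(`pencilQuotient_mul`). So for a solution X the characteristic polynomial divides φ, and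
eigenvectors of X lie in the kernels of the A(μ). Suppose φ is separable, each kernel at a root is a
line, and any n of these lines span the space. Then solutions correspond to n-subsets of roots
(`IsGenericEigensystem.bijOn`). Separability also makes Q(μ) invertible at the eigenvalues of X,
which kills every tangent vector at X; Nakayama then gives multiplicity one.

These properties come from a change of transcendence basis. With the other rows fixed, φ is linear
in the first row of the pencil: n(k+1) unknowns and kn+1 coefficients of φ. Adjoining n-1 constant
terms of that row gives a square system, invertible because it is so for a bidiagonal pencil. Hence
all entries are rational in the other rows, these constant terms, the leading coefficient and the
roots of φ; by counting, these parameters form a transcendence basis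
(`isTranscendenceBasis_rootParams`). Thus the roots are distinct, and a Vandermonde specialization
shows that the eigenvectors, which are cofactor columns, are in general position. Any permutation of
the roots extends to an automorphism of Ω fixing the remaining parameters; it fixes φ, hence the
first row, hence K. So the Galois group is the full symmetric group.

A solution is determined by its characteristic polynomial, and n-subsets separate the roots because
0 < n < kn. Therefore the same automorphisms fix all roots and all solutions, and the two fields
coincide (`IsGenericEigensystem.adjoin_entries_eq`). Solvability by radicals fails when kn ≥ 5
because the symmetric group is not solvable; in the remaining case n = k = 2, φ is a quartic. -/

noncomputable section

universe u

/-! ### Points without tangent vectors have multiplicity one -/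

section Multiplicity

variable {σ ι L : Type*} [Field L]

/-- The `L`-algebra map `f ↦ f(x) + ε ℓ(f)`. -/
def tangentHom (x : σ → L) (l : MvPolynomial σ L →ₗ[L] L) (h1 : l 1 = 0)
    (hmul : ∀ p q, l (p * q) = MvPolynomial.eval x p * l q + l p * MvPolynomial.eval x q) :
    MvPolynomial σ L →ₐ[L] DualNumber L :=
  AlgHom.ofLinearMap
    { toFun := fun p => TrivSqZeroExt.inl (MvPolynomial.eval x p) + TrivSqZeroExt.inr (l p)
      map_add' := fun p q => by
        simp only [map_add, TrivSqZeroExt.inl_add, TrivSqZeroExt.inr_add]; abel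
      map_smul' := fun c p => by
        ext <;> simp [MvPolynomial.smul_eval] }
    (by simp [h1])
    (fun p q => by
      ext
      · simp
      · simp [hmul, mul_comm])

theorem exists_linearMap_of_not_mem {V : Type*} [AddCommGroup V] [Module L V]
    (W : Submodule L V) {v : V} (hv : v ∉ W) :
    ∃ l : V →ₗ[L] L, (∀ w ∈ W, l w = 0) ∧ l v ≠ 0 := by
  obtain ⟨l, h, h2⟩ := Submodule.exists_le_ker_of_notMem hv
  exact ⟨l, fun w hw => by simpa using h2 hw, h⟩

/-- If the only tangent vector at `x` is zero, the ideal of the system generates the cotangent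
space. -/
theorem pointIdeal_le_sup_sq (f : ι → MvPolynomial σ L) (x : σ → L)
    (hx : ∀ i, MvPolynomial.eval x (f i) = 0)
    (hJ : ∀ h : σ → L, (∀ i, MvPolynomial.aeval
      (fun s => (TrivSqZeroExt.inl (x s) + TrivSqZeroExt.inr (h s) : DualNumber L)) (f i) = 0) →
        h = 0) :
    pointIdeal x ≤ Ideal.span (Set.range f) ⊔ pointIdeal x ^ 2 := by
  intro g hg
  by_contra hgW
  set I := Ideal.span (Set.range f) ⊔ pointIdeal x ^ 2 with hI
  obtain ⟨l₀, hl₀, hlg⟩ := exists_linearMap_of_not_mem (I.restrictScalars L) (v := g)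
    (by simpa using hgW)
  -- Subtracting a multiple of the evaluation makes the functional vanish on constants. As `l₀`
  -- kills the square of the maximal ideal, the result is a derivation at `x`.
  let l : MvPolynomial σ L →ₗ[L] L :=
    l₀ - (MvPolynomial.aeval x : MvPolynomial σ L →ₐ[L] L).toLinearMap.smulRight (l₀ 1)
  have hl : ∀ p, l p = l₀ p - MvPolynomial.eval x p * l₀ 1 := fun p => rfl
  have hmul : ∀ p q, l (p * q) = MvPolynomial.eval x p * l q + l p * MvPolynomial.eval x q := by
    intro p q
    have h : (p - MvPolynomial.C (MvPolynomial.eval x p)) *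
        (q - MvPolynomial.C (MvPolynomial.eval x q)) ∈ I := by
      refine Ideal.mem_sup_right ?_
      rw [pow_two]
      exact Ideal.mul_mem_mul (by simp [RingHom.mem_ker]) (by simp [RingHom.mem_ker])
    have h2 := hl₀ _ h
    have h3 : (p - MvPolynomial.C (MvPolynomial.eval x p)) *
        (q - MvPolynomial.C (MvPolynomial.eval x q)) = p * q - MvPolynomial.eval x p • q
          - MvPolynomial.eval x q • p
          + (MvPolynomial.eval x p * MvPolynomial.eval x q) • (1 : MvPolynomial σ L) := by
      simp only [MvPolynomial.smul_eq_C_mul, map_mul]; ring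
    rw [h3] at h2
    simp only [map_add, map_sub, map_smul, smul_eq_mul] at h2
    simp only [hl, map_mul]
    linear_combination h2
  let T := tangentHom x l (by simp [hl]) hmul
  have hTp : ∀ p, T p = TrivSqZeroExt.inl (MvPolynomial.eval x p) + TrivSqZeroExt.inr (l p) :=
    fun p => rfl
  have hT : T = MvPolynomial.aeval (fun s => (TrivSqZeroExt.inl (x s) +
      TrivSqZeroExt.inr (l (MvPolynomial.X s)) : DualNumber L)) := by
    ext s : 1
    simp [hTp]
  -- The values of `l` on the variables form a tangent vector of the system, hence vanish. Then `T`
  -- is evaluation at `x`, which forces `l g = 0`.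
  have h0 := hJ (fun s => l (MvPolynomial.X s)) (fun i => by
    rw [← hT, hTp, hx, hl, hl₀ (f i) (Ideal.mem_sup_left (Ideal.subset_span ⟨i, rfl⟩)), hx]
    simp)
  have h1 : T g = algebraMap L (DualNumber L) (MvPolynomial.eval x g) := by
    rw [hT]
    have : (fun s => (TrivSqZeroExt.inl (x s) +
      TrivSqZeroExt.inr (l (MvPolynomial.X s)) : DualNumber L)) =
        fun s => algebraMap L (DualNumber L) (x s) := by
      funext s
      have := congrFun h0 s
      simp only [Pi.zero_apply] at this
      rw [this, TrivSqZeroExt.inr_zero, add_zero]; rfl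
    rw [this]
    exact (MvPolynomial.aeval_algebraMap_apply (DualNumber L) x g).trans rfl
  have hg0 : MvPolynomial.eval x g = 0 := hg
  have h2 := congrArg TrivSqZeroExt.snd h1
  rw [hTp, hl, hg0] at h2
  simp at h2
  exact hlg h2

/-- Locally the maximal ideal is contained in the sum of the ideal of the system and its own square,
so by Nakayama it equals the ideal of the system. The quotient is the residue field, which is `L`
because `x` is rational. -/
theorem systemMultiplicity_eq_one [Finite σ] (f : ι → MvPolynomial σ L) (x : σ → L)
    (hx : ∀ i, MvPolynomial.eval x (f i) = 0)
    (hJ : ∀ h : σ → L, (∀ i, MvPolynomial.aeval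
      (fun s => (TrivSqZeroExt.inl (x s) + TrivSqZeroExt.inr (h s) : DualNumber L)) (f i) = 0) →
        h = 0) :
    systemMultiplicity f x = 1 := by
  have hle := pointIdeal_le_sup_sq f x hx hJ
  set m := pointIdeal x with hm
  set R := LocalRingAt x
  set I' := (Ideal.span (Set.range f)).map (algebraMap (MvPolynomial σ L) R) with hI'
  have hmap : m.map (algebraMap (MvPolynomial σ L) R) = IsLocalRing.maximalIdeal R :=
    Localization.AtPrime.map_eq_maximalIdeal
  have hI'le : I' ≤ IsLocalRing.maximalIdeal R := by
    rw [← hmap]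
    refine Ideal.map_mono (Ideal.span_le.2 ?_)
    rintro _ ⟨i, rfl⟩
    exact hx i
  have hle' : IsLocalRing.maximalIdeal R ≤ I' := by
    have h := Ideal.map_mono (f := algebraMap (MvPolynomial σ L) R) hle
    rw [Ideal.map_sup, Ideal.map_pow, hmap, pow_two] at h
    refine Submodule.le_of_le_smul_of_le_jacobson_bot (I := IsLocalRing.maximalIdeal R) ?_ ?_ h
    · rw [← hmap]
      exact Ideal.FG.map ((isNoetherianRing_iff_ideal_fg _).1 inferInstance _) _
    · rw [IsLocalRing.jacobson_eq_maximalIdeal _ bot_ne_top]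
  have hEq : I' = IsLocalRing.maximalIdeal R := le_antisymm hI'le hle'
  change Module.finrank L (R ⧸ I') = 1
  have : Nontrivial (R ⧸ I') := Ideal.Quotient.nontrivial_iff.2 (by
    rw [hEq]; exact (IsLocalRing.maximalIdeal.isMaximal R).ne_top)
  refine (finrank_eq_one_iff_of_nonzero' (1 : R ⧸ I') one_ne_zero).2 fun w => ?_
  obtain ⟨z, rfl⟩ := Ideal.Quotient.mk_surjective w
  obtain ⟨r, s, rfl⟩ := IsLocalization.exists_mk'_eq m.primeCompl z
  have hs : MvPolynomial.eval x (s : MvPolynomial σ L) ≠ 0 := s.2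
  -- Modulo the maximal ideal a fraction r/s is the constant r(x)/s(x).
  refine ⟨MvPolynomial.eval x r / MvPolynomial.eval x (s : MvPolynomial σ L), ?_⟩
  rw [← Algebra.algebraMap_eq_smul_one]
  change Ideal.Quotient.mk I' (algebraMap L R _) = _
  rw [Ideal.Quotient.eq, hEq]
  rw [← Ideal.mul_unit_mem_iff_mem _ (IsLocalization.map_units R s), sub_mul,
    IsLocalization.mk'_spec, IsScalarTower.algebraMap_apply L (MvPolynomial σ L) R, ← map_mul,
    ← map_sub, ← hmap]
  refine Ideal.mem_map_of_mem _ ?_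
  change MvPolynomial.eval x _ = 0
  simp [MvPolynomial.algebraMap_eq, div_mul_cancel₀ _ hs]

end Multiplicity

/-! ### Dividing the pencil by μ - X -/

section Solutions

variable {n k : ℕ} {K : Type*} [Field K] (A : Fin (k + 1) → Matrix (Fin n) (Fin n) K)

theorem unilateral_map {R S : Type*} [CommRing R] [CommRing S] [Algebra K R] [Algebra K S]
    (f : R →ₐ[K] S) (X : Matrix (Fin n) (Fin n) R) :
    unilateral A (X.map f) = (unilateral A X).map f := by
  simp only [unilateral]
  rw [← AlgHom.mapMatrix_apply, ← AlgHom.mapMatrix_apply, map_sum]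
  refine Finset.sum_congr rfl fun r _ => ?_
  rw [map_mul, map_pow]
  congr 1
  ext i j
  simp

theorem matrixPencil_map {R S : Type*} [CommRing R] [CommRing S] [Algebra K R] [Algebra K S]
    (f : R →ₐ[K] S) (μ : R) : matrixPencil A (f μ) = (matrixPencil A μ).map f := by
  ext i j
  simp [matrixPencil, Matrix.sum_apply]

/-- The left quotient of `A(μ) - A(X)` by `μ - X`. -/
def pencilQuotient {R : Type*} [CommRing R] [Algebra K R] (X : Matrix (Fin n) (Fin n) R) (μ : R) :
    Matrix (Fin n) (Fin n) R :=
  ∑ r : Fin (k + 1), (A r).map (algebraMap K R) *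
    ∑ i ∈ Finset.range r, Matrix.scalar (Fin n) μ ^ i * X ^ ((r : ℕ) - 1 - i)

/-- μ and X commute, so μ^r - X^r is the usual geometric sum times μ - X, and the coefficient matrix
stays on the left. -/
theorem pencilQuotient_mul {R : Type*} [CommRing R] [Algebra K R]
    (X : Matrix (Fin n) (Fin n) R) (μ : R) :
    pencilQuotient A X μ * (Matrix.scalar (Fin n) μ - X) =
      matrixPencil A μ - unilateral A X := by
  have hc : Commute (Matrix.scalar (Fin n) μ) X := Matrix.scalar_commute μ (Commute.all _) X
  rw [pencilQuotient, matrixPencil, unilateral, Finset.sum_mul]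
  rw [← Finset.sum_sub_distrib]
  refine Finset.sum_congr rfl fun r _ => ?_
  rw [mul_assoc, hc.geom_sum₂_mul, mul_sub, ← map_pow]
  congr 1
  ext i j
  simp [mul_comm]

theorem pencilQuotient_map {R S : Type*} [CommRing R] [CommRing S] [Algebra K R] [Algebra K S]
    (f : R →ₐ[K] S) (X : Matrix (Fin n) (Fin n) R) (μ : R) :
    pencilQuotient A (X.map f) (f μ) = (pencilQuotient A X μ).map f := by
  simp only [pencilQuotient]
  rw [← AlgHom.mapMatrix_apply, ← AlgHom.mapMatrix_apply, map_sum]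
  refine Finset.sum_congr rfl fun r _ => ?_
  rw [map_mul, map_sum]
  congr 1
  · ext i j
    simp
  · refine Finset.sum_congr rfl fun i _ => ?_
    rw [map_mul, map_pow, map_pow]
    congr 2
    ext i j
    by_cases h : i = j <;> simp [h]

variable {Ω : Type*} [Field Ω] [Algebra K Ω]

theorem pencilDet_map :
    (pencilDet A).map (algebraMap K Ω) = (matrixPencil A (Polynomial.X : Polynomial Ω)).det := by
  have h := matrixPencil_map A (Polynomial.mapAlg K Ω) (X : K[X])
  rw [Polynomial.mapAlg_eq_map, Polynomial.map_X] at h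
  rw [h, pencilDet, ← AlgHom.mapMatrix_apply, ← AlgHom.map_det, Polynomial.mapAlg_eq_map]

theorem aeval_pencilDet (μ : Ω) : aeval μ (pencilDet A) = (matrixPencil A μ).det := by
  have h := matrixPencil_map A (Polynomial.aeval μ : K[X] →ₐ[K] Ω) (X : K[X])
  rw [aeval_X] at h
  rw [h, pencilDet, ← AlgHom.mapMatrix_apply, ← AlgHom.map_det]

variable {A}

theorem pencilDet_map_eq {X₀ : Matrix (Fin n) (Fin n) Ω} (hX : X₀ ∈ unilateralSolutions A Ω) :
    (pencilDet A).map (algebraMap K Ω) =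
      (pencilQuotient A (X₀.map C) (X : Polynomial Ω)).det * X₀.charpoly := by
  have h := pencilQuotient_mul A (X₀.map C) (X : Polynomial Ω)
  have h0 : unilateral A (X₀.map C) = 0 := by
    have := unilateral_map A (IsScalarTower.toAlgHom K Ω (Polynomial Ω)) X₀
    rw [show unilateral A X₀ = 0 from hX, Matrix.map_zero _ (map_zero _)] at this
    exact this
  rw [h0, sub_zero] at h
  rw [pencilDet_map, ← h, Matrix.det_mul, Matrix.charpoly, Matrix.charmatrix]
  rfl

theorem charpoly_dvd_pencilDet {X₀ : Matrix (Fin n) (Fin n) Ω}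
    (hX : X₀ ∈ unilateralSolutions A Ω) :
    X₀.charpoly ∣ (pencilDet A).map (algebraMap K Ω) :=
  ⟨_, (pencilDet_map_eq hX).trans (mul_comm _ _)⟩

theorem exists_eigenvector_of_isRoot {X₀ : Matrix (Fin n) (Fin n) Ω} {μ : Ω}
    (h : X₀.charpoly.IsRoot μ) : ∃ v ≠ 0, X₀.mulVec v = μ • v := by
  rw [Polynomial.IsRoot, Matrix.eval_charpoly] at h
  obtain ⟨v, hv, h⟩ := Matrix.exists_mulVec_eq_zero_iff.2 h
  refine ⟨v, hv, ?_⟩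
  rw [Matrix.sub_mulVec, sub_eq_zero] at h
  rw [← h]
  ext i
  simp [Matrix.mulVec_diagonal]

theorem matrixPencil_mulVec_of_eigenvector {X₀ : Matrix (Fin n) (Fin n) Ω}
    (hX : X₀ ∈ unilateralSolutions A Ω) {μ : Ω} {v : Fin n → Ω}
    (h : X₀.mulVec v = μ • v) : (matrixPencil A μ).mulVec v = 0 := by
  have h1 := pencilQuotient_mul A X₀ μ
  rw [show unilateral A X₀ = 0 from hX, sub_zero] at h1
  rw [← h1, ← Matrix.mulVec_mulVec, Matrix.sub_mulVec, h]
  have h2 : (Matrix.scalar (Fin n) μ).mulVec v - μ • v = 0 := by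
    ext i
    simp
  rw [h2, Matrix.mulVec_zero]

/-- Otherwise μ would be a root of both factors in `pencilDet_map_eq`, hence a multiple root of φ.
-/
theorem det_pencilQuotient_ne_zero {X₀ : Matrix (Fin n) (Fin n) Ω}
    (hX : X₀ ∈ unilateralSolutions A Ω)
    (hsep : ((pencilDet A).map (algebraMap K Ω)).Separable) {μ : Ω}
    (h : X₀.charpoly.IsRoot μ) : (pencilQuotient A X₀ μ).det ≠ 0 := by
  intro h0
  rw [pencilDet_map_eq hX] at hsep
  have h1 := hsep.isCoprime
  have h2 : (pencilQuotient A (X₀.map C) (X : Polynomial Ω)).det.eval μ = (pencilQuotient A X₀ μ).det := by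
    have h := pencilQuotient_map A ((Polynomial.aeval μ : Polynomial Ω →ₐ[Ω] Ω).restrictScalars K)
      (X₀.map C) X
    rw [AlgHom.restrictScalars_apply, aeval_X] at h
    have h3 : (X₀.map C).map ((Polynomial.aeval μ : Polynomial Ω →ₐ[Ω] Ω).restrictScalars K) = X₀ := by
      ext i j
      simp
    rw [h3] at h
    rw [h, ← AlgHom.mapMatrix_apply, ← AlgHom.map_det, AlgHom.restrictScalars_apply,
      Polynomial.coe_aeval_eq_eval]
  obtain ⟨a, b, hab⟩ := h1
  have := congrArg (Polynomial.eval μ) hab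
  rw [eval_add, eval_mul, eval_mul, h2, h0, show X₀.charpoly.eval μ = 0 from h] at this
  simp at this

end Solutions

/-! ### Solutions as n-subsets of eigenvalues -/

section Eigensystem

variable {n k m : ℕ} {K : Type*} [Field K] {A : Fin (k + 1) → Matrix (Fin n) (Fin n) K}
  {Ω : Type*} [Field Ω] [Algebra K Ω]

theorem eigenvectorMatrix_mulVec_single (u : Fin m → Fin n → Ω) (J : Fin n ↪o Fin m) (b : Fin n) :
    (eigenvectorMatrix u J).mulVec (Pi.single b 1) = u (J b) := by
  ext a
  simp [eigenvectorMatrix]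

theorem solutionOfSubset_mulVec {ev : Fin m → Ω} {u : Fin m → Fin n → Ω} {J : Fin n ↪o Fin m}
    (hP : IsUnit (eigenvectorMatrix u J).det) (b : Fin n) :
    (solutionOfSubset ev u J).mulVec (u (J b)) = ev (J b) • u (J b) := by
  have h := eigenvectorMatrix_mulVec_single u J b
  rw [← h, solutionOfSubset, Matrix.mulVec_mulVec, mul_assoc, mul_assoc,
    Matrix.nonsing_inv_mul _ hP, mul_one, ← Matrix.mulVec_mulVec]
  have h2 : (Matrix.diagonal fun b => ev (J b)).mulVec (Pi.single b 1) =
      ev (J b) • (Pi.single b 1 : Fin n → Ω) := by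
    ext a
    by_cases hab : a = b
    · subst hab; simp
    · simp [hab]
  rw [h2, Matrix.mulVec_smul]

theorem eq_of_mulVec_eq {u : Fin m → Fin n → Ω} {J : Fin n ↪o Fin m}
    (hP : IsUnit (eigenvectorMatrix u J).det) {M N : Matrix (Fin n) (Fin n) Ω}
    (h : ∀ b, M.mulVec (u (J b)) = N.mulVec (u (J b))) : M = N := by
  have h1 : M * eigenvectorMatrix u J = N * eigenvectorMatrix u J := by
    refine Matrix.ext_of_mulVec_single fun b => ?_
    rw [← Matrix.mulVec_mulVec, ← Matrix.mulVec_mulVec, eigenvectorMatrix_mulVec_single, h]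
  rw [← mul_one M, ← mul_one N, ← Matrix.mul_nonsing_inv _ hP, ← mul_assoc, h1, mul_assoc]

theorem unilateral_mulVec_of_eigenvector {X₀ : Matrix (Fin n) (Fin n) Ω} {μ : Ω} {v : Fin n → Ω}
    (h : X₀.mulVec v = μ • v) : (unilateral A X₀).mulVec v = (matrixPencil A μ).mulVec v := by
  have h1 := congrArg (fun M => Matrix.mulVec M v) (pencilQuotient_mul A X₀ μ)
  have h2 : (Matrix.scalar (Fin n) μ).mulVec v - μ • v = 0 := by
    ext i
    simp
  rw [← Matrix.mulVec_mulVec, Matrix.sub_mulVec, Matrix.sub_mulVec, h, h2,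
    Matrix.mulVec_zero, eq_comm, sub_eq_zero] at h1
  exact h1.symm

theorem charpoly_solutionOfSubset (ev : Fin m → Ω) {u : Fin m → Fin n → Ω} {J : Fin n ↪o Fin m}
    (hP : IsUnit (eigenvectorMatrix u J).det) :
    (solutionOfSubset ev u J).charpoly = ∏ b, (X - C (ev (J b))) := by
  have h := Matrix.charpoly_units_conj (Matrix.nonsingInvUnit _ hP)
    (Matrix.diagonal fun b => ev (J b))
  rw [Matrix.charpoly_diagonal] at h
  rw [← h]
  rfl

theorem dualNumber_mulVec_inr (Q : Matrix (Fin n) (Fin n) (DualNumber Ω)) (w : Fin n → Ω) :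
    Q.mulVec (fun a => (TrivSqZeroExt.inr (w a) : DualNumber Ω)) =
      fun a => TrivSqZeroExt.inr ((Q.map TrivSqZeroExt.fst).mulVec w a) := by
  funext a
  simp only [Matrix.mulVec, dotProduct, Matrix.map_apply]
  rw [TrivSqZeroExt.inr_sum]
  refine Finset.sum_congr rfl fun i _ => ?_
  ext <;> simp [mul_comm]

theorem dualNumber_mulVec_inl (Q : Matrix (Fin n) (Fin n) (DualNumber Ω)) (w : Fin n → Ω) :
    Q.mulVec (fun a => (TrivSqZeroExt.inl (w a) : DualNumber Ω)) = fun a =>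
      TrivSqZeroExt.inl ((Q.map TrivSqZeroExt.fst).mulVec w a) +
        TrivSqZeroExt.inr ((Q.map TrivSqZeroExt.snd).mulVec w a) := by
  funext a
  simp only [Matrix.mulVec, dotProduct, Matrix.map_apply]
  rw [TrivSqZeroExt.inr_sum, TrivSqZeroExt.inl_sum, ← Finset.sum_add_distrib]
  refine Finset.sum_congr rfl fun i _ => ?_
  ext <;> simp [mul_comm]

variable (A) in
/-- The eigenvalues `ev i` are the roots of the separable polynomial `φ`, the corresponding
eigenspaces are the lines spanned by the `u i`, and any `n` of these lines span the space. -/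
structure IsGenericEigensystem (ev : Fin m → Ω) (u : Fin m → Fin n → Ω) : Prop where
  separable : ((pencilDet A).map (algebraMap K Ω)).Separable
  injective : Function.Injective ev
  range_eq : Set.range ev = (pencilDet A).rootSet Ω
  ne_zero : ∀ i, u i ≠ 0
  mulVec_eq_zero : ∀ i, (matrixPencil A (ev i)).mulVec (u i) = 0
  exists_eq_smul : ∀ i v, (matrixPencil A (ev i)).mulVec v = 0 → ∃ t : Ω, v = t • u i
  isUnit_det : ∀ J : Fin n ↪o Fin m, IsUnit (eigenvectorMatrix u J).det

namespace IsGenericEigensystem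

variable {ev : Fin m → Ω} {u : Fin m → Fin n → Ω}

/-- On the basis of selected eigenvectors, A(X) acts on each one as the pencil at its eigenvalue,
which kills it. -/
theorem solutionOfSubset_mem (H : IsGenericEigensystem A ev u) (J : Fin n ↪o Fin m) :
    solutionOfSubset ev u J ∈ unilateralSolutions A Ω := by
  refine eq_of_mulVec_eq (H.isUnit_det J) fun b => ?_
  rw [unilateral_mulVec_of_eigenvector (solutionOfSubset_mulVec (H.isUnit_det J) b),
    H.mulVec_eq_zero, Matrix.zero_mulVec]

theorem isRoot_charpoly_solutionOfSubset (H : IsGenericEigensystem A ev u) (J : Fin n ↪o Fin m)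
    (i : Fin m) : (solutionOfSubset ev u J).charpoly.IsRoot (ev i) ↔ i ∈ Set.range J := by
  rw [charpoly_solutionOfSubset ev (H.isUnit_det J), Polynomial.IsRoot, eval_prod,
    Finset.prod_eq_zero_iff]
  simp only [eval_sub, eval_X, eval_C, sub_eq_zero, H.injective.eq_iff, Finset.mem_univ,
    true_and, Set.mem_range, eq_comm (b := i)]

theorem solutionOfSubset_injective (H : IsGenericEigensystem A ev u) :
    Function.Injective (solutionOfSubset ev u : (Fin n ↪o Fin m) → _) := by
  intro J J' h
  have : Set.range J = Set.range J' := by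
    ext i
    rw [← H.isRoot_charpoly_solutionOfSubset, h, H.isRoot_charpoly_solutionOfSubset]
  exact DFunLike.coe_injective
    ((StrictMono.range_inj J.strictMono J'.strictMono).1 this)

theorem eigenvalue_mulVec (H : IsGenericEigensystem A ev u) {X₀ : Matrix (Fin n) (Fin n) Ω}
    (hX : X₀ ∈ unilateralSolutions A Ω) {i : Fin m} (h : X₀.charpoly.IsRoot (ev i)) :
    X₀.mulVec (u i) = ev i • u i := by
  obtain ⟨v, hv, hXv⟩ := exists_eigenvector_of_isRoot h
  obtain ⟨t, rfl⟩ := H.exists_eq_smul i v (matrixPencil_mulVec_of_eigenvector hX hXv)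
  have ht : t ≠ 0 := fun h0 => hv (by simp [h0])
  rw [Matrix.mulVec_smul, smul_comm] at hXv
  exact smul_right_injective _ ht hXv

/-- The characteristic polynomial divides the separable φ, so it has n distinct roots. Each kernel
being a line, the eigenvectors are the prescribed ones, and a matrix is determined by its values on
a basis. -/
theorem exists_eq_solutionOfSubset [IsAlgClosed Ω] (H : IsGenericEigensystem A ev u)
    {X₀ : Matrix (Fin n) (Fin n) Ω} (hX : X₀ ∈ unilateralSolutions A Ω) :
    ∃ J : Fin n ↪o Fin m, solutionOfSubset ev u J = X₀ := by
  classical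
  have hdvd := charpoly_dvd_pencilDet hX
  have hsep := H.separable.of_dvd hdvd
  have hne : X₀.charpoly ≠ 0 := X₀.charpoly_monic.ne_zero
  have hmem : ∀ μ ∈ X₀.charpoly.roots.toFinset, μ ∈ Set.range ev := fun μ hμ => by
    rw [H.range_eq, Polynomial.rootSet, Finset.mem_coe, Multiset.mem_toFinset, aroots_def]
    exact Multiset.mem_of_le (roots.le_of_dvd H.separable.ne_zero hdvd) (by simpa using hμ)
  have hcard : X₀.charpoly.roots.toFinset.card = n := by
    rw [Multiset.toFinset_card_of_nodup (nodup_roots hsep),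
      ← (IsAlgClosed.splits X₀.charpoly).natDegree_eq_card_roots, X₀.charpoly_natDegree_eq_dim,
      Fintype.card_fin]
  let T : Finset (Fin m) := X₀.charpoly.roots.toFinset.preimage ev H.injective.injOn
  have hT : T.card = n := by
    rw [← hcard, Finset.card_preimage]
    congr 1
    rw [Finset.filter_true_of_mem hmem]
  refine ⟨T.orderEmbOfFin hT, eq_of_mulVec_eq (H.isUnit_det (T.orderEmbOfFin hT)) fun b => ?_⟩
  rw [solutionOfSubset_mulVec (H.isUnit_det _), H.eigenvalue_mulVec hX]
  have := Finset.orderEmbOfFin_mem T hT b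
  rw [Finset.mem_preimage, Multiset.mem_toFinset, mem_roots hne] at this
  exact this

theorem bijOn [IsAlgClosed Ω] (H : IsGenericEigensystem A ev u) :
    Set.BijOn (solutionOfSubset ev u) Set.univ (unilateralSolutions A Ω) :=
  ⟨fun J _ => H.solutionOfSubset_mem J, H.solutionOfSubset_injective.injOn,
    fun _ hX => let ⟨J, hJ⟩ := H.exists_eq_solutionOfSubset hX; ⟨J, trivial, hJ⟩⟩

theorem unilateralSolutions_finite [IsAlgClosed Ω] (H : IsGenericEigensystem A ev u) :
    (unilateralSolutions A Ω).Finite := by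
  rw [← H.bijOn.image_eq]
  exact Set.toFinite _

theorem ncard_unilateralSolutions [IsAlgClosed Ω] (H : IsGenericEigensystem A ev u) :
    (unilateralSolutions A Ω).ncard = m.choose n := by
  rw [← H.bijOn.image_eq, Set.ncard_image_of_injective _ H.solutionOfSubset_injective,
    Set.ncard_univ, Nat.card_congr Set.powersetCard.ofFinEmbEquiv, Set.powersetCard.card,
    Nat.card_fin]

theorem eq_of_charpoly_eq [IsAlgClosed Ω] (H : IsGenericEigensystem A ev u)
    {X₀ Y₀ : Matrix (Fin n) (Fin n) Ω} (hX : X₀ ∈ unilateralSolutions A Ω)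
    (hY : Y₀ ∈ unilateralSolutions A Ω) (h : X₀.charpoly = Y₀.charpoly) : X₀ = Y₀ := by
  obtain ⟨J, rfl⟩ := H.exists_eq_solutionOfSubset hX
  refine eq_of_mulVec_eq (H.isUnit_det J) fun b => ?_
  have hb := (H.isRoot_charpoly_solutionOfSubset J (J b)).2 ⟨b, rfl⟩
  rw [H.eigenvalue_mulVec hX hb, H.eigenvalue_mulVec hY (h ▸ hb)]

/-- Let Y = X₀ + εN be a solution over the dual numbers and v an eigenvector of X₀ for μ. Apply
Q(μ)(μ - Y) = A(μ) to v: since (μ - Y)v = -εNv and A(μ)v has no ε-part, the quotient at X₀ kills Nv.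
That quotient is invertible, so N vanishes on a basis. -/
theorem isSimpleSolution [IsAlgClosed Ω] (H : IsGenericEigensystem A ev u)
    {X₀ : Matrix (Fin n) (Fin n) Ω} (hX : X₀ ∈ unilateralSolutions A Ω) :
    IsSimpleSolution A X₀ := by
  have key : ∀ {R : Type _} [CommRing R] [Algebra K R] [Algebra Ω R] [IsScalarTower K Ω R]
      (x : Fin n × Fin n → R) (p : Fin n × Fin n),
      MvPolynomial.aeval x (unilateralSystem A Ω p) =
        unilateral A (Matrix.of fun a b => x (a, b)) p.1 p.2 := by
    intro R _ _ _ _ x p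
    have h := unilateral_map A ((MvPolynomial.aeval x : _ →ₐ[Ω] R).restrictScalars K)
      (Matrix.mvPolynomialX (Fin n) (Fin n) Ω)
    have h2 : (Matrix.mvPolynomialX (Fin n) (Fin n) Ω).map
        ((MvPolynomial.aeval x : _ →ₐ[Ω] R).restrictScalars K) =
          Matrix.of fun a b => x (a, b) := by
      ext a b
      simp
    rw [h2] at h
    rw [h]
    rfl
  refine ⟨hX, systemMultiplicity_eq_one _ _ (fun p => ?_) fun h hh => ?_⟩
  · have := key (fun p : Fin n × Fin n => X₀ p.1 p.2) p
    exact this.trans (congrFun (congrFun hX p.1) p.2)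
  · let D := DualNumber Ω
    let N : Matrix (Fin n) (Fin n) Ω := Matrix.of fun a b => h (a, b)
    let Y : Matrix (Fin n) (Fin n) D :=
      Matrix.of fun a b => TrivSqZeroExt.inl (X₀ a b) + TrivSqZeroExt.inr (h (a, b))
    have hY : unilateral A Y = 0 := by
      ext1 a b
      rw [← key (fun s => (TrivSqZeroExt.inl (X₀ s.1 s.2) + TrivSqZeroExt.inr (h s) : D)) (a, b)]
      exact hh (a, b)
    obtain ⟨J, rfl⟩ := H.exists_eq_solutionOfSubset hX
    set X₁ := solutionOfSubset ev u J with hX₁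
    have hfst : Y.map (TrivSqZeroExt.fstHom K Ω Ω) = X₁ := by
      ext a b
      exact add_zero _
    suffices hN : N = 0 by
      funext p
      exact congrFun (congrFun hN p.1) p.2
    refine eq_of_mulVec_eq (H.isUnit_det J) fun b => ?_
    rw [Matrix.zero_mulVec]
    have hb := (H.isRoot_charpoly_solutionOfSubset J (J b)).2 ⟨b, rfl⟩
    have hv := H.eigenvalue_mulVec hX hb
    set v := u (J b)
    set μ := ev (J b)
    set Q := pencilQuotient A Y (TrivSqZeroExt.inl μ : D) with hQdef
    have hQ : Q.map (TrivSqZeroExt.fstHom K Ω Ω) = pencilQuotient A X₁ μ := by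
      have := pencilQuotient_map A (TrivSqZeroExt.fstHom K Ω Ω) Y (TrivSqZeroExt.inl μ)
      rw [hfst] at this
      exact this.symm
    have h1 := pencilQuotient_mul A Y (TrivSqZeroExt.inl μ : D)
    rw [hY, sub_zero] at h1
    have h2 : matrixPencil A (TrivSqZeroExt.inl μ : D) =
        (matrixPencil A μ).map (TrivSqZeroExt.inl : Ω → D) :=
      matrixPencil_map A (IsScalarTower.toAlgHom K Ω D) μ
    have hdet := det_pencilQuotient_ne_zero hX H.separable hb
    have h3 : (pencilQuotient A X₁ μ).mulVec (N.mulVec v) = 0 := by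
      have h4 := congrArg (fun M => M.mulVec fun a => (TrivSqZeroExt.inl (v a) : D)) h1
      have hf : (Matrix.scalar (Fin n) (TrivSqZeroExt.inl μ : D) - Y).map TrivSqZeroExt.fst =
          Matrix.scalar (Fin n) μ - X₁ := by
        rw [← hfst]
        ext a b
        by_cases hab : a = b <;> simp [hab]
      have hs : (Matrix.scalar (Fin n) (TrivSqZeroExt.inl μ : D) - Y).map TrivSqZeroExt.snd =
          -N := by
        have hsnd : Y.map TrivSqZeroExt.snd = N := by
          ext a b
          exact zero_add _
        rw [← hsnd]
        ext a b
        by_cases hab : a = b <;> simp [hab]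
      have h5 : (Matrix.scalar (Fin n) μ - X₁).mulVec v = 0 := by
        rw [Matrix.sub_mulVec, hv]
        ext i
        simp
      have h6 : (Matrix.map (Matrix.map (matrixPencil A μ) (TrivSqZeroExt.inl : Ω → D))
          TrivSqZeroExt.snd) = 0 := by
        ext a b
        rfl
      simp only [← Matrix.mulVec_mulVec] at h4
      rw [dualNumber_mulVec_inl _ v, hf, hs, h5, h2, dualNumber_mulVec_inl, h6] at h4
      simp only [Pi.zero_apply, TrivSqZeroExt.inl_zero, zero_add] at h4
      rw [dualNumber_mulVec_inr] at h4
      funext a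
      have h7 := congrArg TrivSqZeroExt.snd (congrFun h4 a)
      have h8 : Q.map TrivSqZeroExt.fst = pencilQuotient A X₁ μ := hQ
      rw [← hQdef, h8, TrivSqZeroExt.snd_inr, Matrix.neg_mulVec, Matrix.mulVec_neg] at h7
      simpa using h7
    exact Matrix.eq_zero_of_mulVec_eq_zero hdet h3

end IsGenericEigensystem

end Eigensystem

/-! ### The determinant as a linear function of the first row -/

section Cofactors

variable {n d k : ℕ} {R S : Type*} [CommRing R] [CommRing S]

/-- The matrix polynomial `A_k X^k + ⋯ + A_1 X + A_0` over a commutative ring. -/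
def coeffPencil (A : Fin (k + 1) → Matrix (Fin n) (Fin n) R) : Matrix (Fin n) (Fin n) R[X] :=
  Matrix.of fun i j => ∑ r : Fin (k + 1), C (A r i j) * X ^ (r : ℕ)

theorem coeffPencil_map (f : R →+* S) (A : Fin (k + 1) → Matrix (Fin n) (Fin n) R) :
    coeffPencil (fun r => (A r).map f) = (coeffPencil A).map (Polynomial.mapRingHom f) := by
  ext1 i j
  simp [coeffPencil, Polynomial.map_sum]

theorem natDegree_coeffPencil_le (A : Fin (k + 1) → Matrix (Fin n) (Fin n) R) (i j : Fin n) :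
    (coeffPencil A i j).natDegree ≤ k := by
  refine natDegree_sum_le_of_forall_le (Finset.univ : Finset (Fin (k + 1))) _ fun r _ => ?_
  exact (natDegree_C_mul_X_pow_le _ _).trans (Nat.lt_succ_iff.1 r.2)

theorem coeff_coeffPencil (A : Fin (k + 1) → Matrix (Fin n) (Fin n) R) (i j : Fin n)
    (r : Fin (k + 1)) : (coeffPencil A i j).coeff r = A r i j := by
  simp only [coeffPencil, Matrix.of_apply, finsetSum_coeff, coeff_C_mul, coeff_X_pow]
  rw [Finset.sum_eq_single r]
  · simp
  · intro b _ hb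
    rw [if_neg (fun h => hb (Fin.ext h.symm)), mul_zero]
  · simp

theorem natDegree_det_coeffPencil_le (A : Fin (k + 1) → Matrix (Fin n) (Fin n) R) :
    (coeffPencil A).det.natDegree ≤ k * n := by
  rw [Matrix.det_apply]
  refine natDegree_sum_le_of_forall_le _ _ fun σ _ => (natDegree_smul_le _ _).trans ?_
  refine (natDegree_prod_le _ _).trans ?_
  refine (Finset.sum_le_card_nsmul _ _ k fun i _ => natDegree_coeffPencil_le A _ _).trans ?_
  simp [mul_comm]

theorem coeff_det_coeffPencil (A : Fin (k + 1) → Matrix (Fin n) (Fin n) R) :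
    (coeffPencil A).det.coeff (k * n) = (A (Fin.last k)).det := by
  rw [Matrix.det_apply, Matrix.det_apply, finsetSum_coeff]
  refine Finset.sum_congr rfl fun σ _ => ?_
  rw [coeff_smul]
  congr 1
  have := coeff_prod_of_natDegree_le (Finset.univ : Finset (Fin n))
    (fun i => coeffPencil A (σ i) i) k fun i _ => natDegree_coeffPencil_le A _ _
  rw [Finset.card_univ, Fintype.card_fin, mul_comm] at this
  rw [this]
  exact Finset.prod_congr rfl fun i _ => coeff_coeffPencil A _ _ (Fin.last k)

/-- The cofactors of `A_k X^k + ⋯ + A_1 X + A_0` along its first row. -/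
def rowCofactor (A : Fin (k + 1) → Matrix (Fin (d + 1)) (Fin (d + 1)) R) (j : Fin (d + 1)) : R[X] :=
  (coeffPencil A).adjugate j 0

theorem rowCofactor_map (f : R →+* S) (A : Fin (k + 1) → Matrix (Fin (d + 1)) (Fin (d + 1)) R)
    (j : Fin (d + 1)) :
    rowCofactor (fun r => (A r).map f) j = (rowCofactor A j).map f := by
  rw [rowCofactor, coeffPencil_map, rowCofactor, ← RingHom.mapMatrix_apply,
    ← RingHom.map_adjugate]
  rfl

/-- The cofactors replace the first row by a unit vector, so that row never enters. -/
theorem rowCofactor_congr {A B : Fin (k + 1) → Matrix (Fin (d + 1)) (Fin (d + 1)) R}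
    (h : ∀ r i j, A r (Fin.succ i) j = B r (Fin.succ i) j) : rowCofactor A = rowCofactor B := by
  funext j
  rw [rowCofactor, rowCofactor, Matrix.adjugate_apply, Matrix.adjugate_apply]
  congr 1
  ext1 a b
  refine Fin.cases ?_ (fun i => ?_) a
  · simp
  · rw [Matrix.updateRow_ne (Fin.succ_ne_zero i), Matrix.updateRow_ne (Fin.succ_ne_zero i)]
    simp [coeffPencil, h]

theorem coeffPencil_mulVec_rowCofactor
    (A : Fin (k + 1) → Matrix (Fin (d + 1)) (Fin (d + 1)) R) :
    (coeffPencil A).mulVec (rowCofactor A) = Pi.single 0 (coeffPencil A).det := by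
  funext i
  have h := congrFun (congrFun (Matrix.mul_adjugate (coeffPencil A)) i) 0
  rw [Matrix.mul_apply] at h
  refine h.trans ?_
  rw [Matrix.smul_apply, Matrix.one_apply, Pi.single_apply]
  simp

theorem sum_mul_rowCofactor (A : Fin (k + 1) → Matrix (Fin (d + 1)) (Fin (d + 1)) R) :
    ∑ j, coeffPencil A 0 j * rowCofactor A j = (coeffPencil A).det := by
  have := congrFun (coeffPencil_mulVec_rowCofactor A) 0
  rwa [Pi.single_eq_same] at this

/-- The matrix of the linear map sending the first row of the matrix polynomial to the
coefficients of its determinant, completed by the constant terms of all entries but the first. -/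
def firstRowMatrix (A : Fin (k + 1) → Matrix (Fin (d + 1)) (Fin (d + 1)) R) :
    Matrix (Fin (d + 1) × Fin (k + 1)) (Fin (d + 1) × Fin (k + 1)) R :=
  Matrix.of fun p q => if p.2 = 0 ∧ p.1 ≠ 0 then (if p = q then 1 else 0) else
    (rowCofactor A q.1 * X ^ (q.2 : ℕ)).coeff (p.1 * k + p.2)

theorem firstRowMatrix_map (f : R →+* S)
    (A : Fin (k + 1) → Matrix (Fin (d + 1)) (Fin (d + 1)) R) :
    firstRowMatrix (fun r => (A r).map f) = (firstRowMatrix A).map f := by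
  ext p q
  simp only [firstRowMatrix, Matrix.of_apply, Matrix.map_apply, rowCofactor_map]
  split_ifs
  · simp
  · simp
  · rw [← Polynomial.map_X f, ← Polynomial.map_pow, ← Polynomial.map_mul, coeff_map]

theorem firstRowMatrix_mulVec (A : Fin (k + 1) → Matrix (Fin (d + 1)) (Fin (d + 1)) R)
    (x : Fin (d + 1) × Fin (k + 1) → R) (p : Fin (d + 1) × Fin (k + 1)) :
    (firstRowMatrix A).mulVec x p = if p.2 = 0 ∧ p.1 ≠ 0 then x p else
      (∑ j, (∑ r : Fin (k + 1), C (x (j, r)) * X ^ (r : ℕ)) * rowCofactor A j).coeff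
        (p.1 * k + p.2) := by
  simp only [Matrix.mulVec, dotProduct, firstRowMatrix, Matrix.of_apply]
  split_ifs with h
  · simp
  · rw [Fintype.sum_prod_type, finsetSum_coeff]
    refine Finset.sum_congr rfl fun j _ => ?_
    rw [Finset.sum_mul, finsetSum_coeff]
    refine Finset.sum_congr rfl fun r _ => ?_
    rw [mul_assoc, coeff_C_mul, mul_comm, mul_comm (rowCofactor A j)]

/-- Laplace expansion along the first row. As the matrix depends on the other rows only, this is a
linear system for the first row whose right-hand side consists of the coefficients of φ and the
chosen constant terms. -/
theorem firstRowMatrix_mulVec_firstRow (A : Fin (k + 1) → Matrix (Fin (d + 1)) (Fin (d + 1)) R)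
    (p : Fin (d + 1) × Fin (k + 1)) :
    (firstRowMatrix A).mulVec (fun q => A q.2 0 q.1) p =
      if p.2 = 0 ∧ p.1 ≠ 0 then A 0 0 p.1 else (coeffPencil A).det.coeff (p.1 * k + p.2) := by
  rw [firstRowMatrix_mulVec, ← sum_mul_rowCofactor]
  split_ifs with h
  · rw [h.1]
  · rfl

end Cofactors

/-! ### A pencil for which the linear system is invertible -/

section Bidiagonal

variable (d k : ℕ) (R : Type*) [CommRing R]

/-- The coefficients of the matrix polynomial with zero first row, and with `X^k` and `-1` at the
positions `i` and `i + 1` of the row `i + 1`. -/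
def bidiagonalPencil : Fin (k + 1) → Matrix (Fin (d + 1)) (Fin (d + 1)) R :=
  fun r => Matrix.of (Fin.cons 0 fun i j =>
    (if r = Fin.last k ∧ j = Fin.castSucc i then 1 else 0) - if r = 0 ∧ j = Fin.succ i then 1 else 0)

variable {d k R}

theorem coeffPencil_bidiagonal (i : Fin d) (j : Fin (d + 1)) :
    coeffPencil (bidiagonalPencil d k R) i.succ j =
      (if j = Fin.castSucc i then X ^ k else 0) - if j = Fin.succ i then 1 else 0 := by
  simp only [coeffPencil, bidiagonalPencil, Matrix.of_apply, Fin.cons_succ, map_sub, sub_mul,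
    Finset.sum_sub_distrib]
  congr 1
  · by_cases h : j = Fin.castSucc i
    · rw [Finset.sum_eq_single (Fin.last k)] <;> simp +contextual [h]
    · simp [h]
  · by_cases h : j = Fin.succ i
    · rw [Finset.sum_eq_single 0] <;> simp +contextual [h]
    · simp [h]

/-- With the first row replaced by the first unit vector the matrix is lower triangular, with
diagonal 1, -1, …, -1. -/
theorem rowCofactor_bidiagonal_zero : rowCofactor (bidiagonalPencil d k R) 0 = (-1) ^ d := by
  rw [rowCofactor, Matrix.adjugate_apply, Matrix.det_of_isLowerTriangular]
  · rw [Fin.prod_univ_succ, Matrix.updateRow_self, Pi.single_eq_same, one_mul]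
    rw [Finset.prod_congr rfl fun i _ => (?_ : _ = (-1 : R[X]))]
    · simp
    · rw [Matrix.updateRow_ne (Fin.succ_ne_zero i), coeffPencil_bidiagonal]
      simp [Fin.castSucc_lt_succ.ne']
  · intro i j hij
    have hij : i < j := hij
    revert hij
    refine Fin.cases (fun hij => ?_) (fun i hij => ?_) i
    · rw [Matrix.updateRow_self, Pi.single_eq_of_ne hij.ne']
    · rw [Matrix.updateRow_ne (Fin.succ_ne_zero i), coeffPencil_bidiagonal, if_neg hij.ne',
        if_neg (Fin.castSucc_lt_succ.trans hij).ne', sub_zero]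

/-- Row i + 1 annihilates the cofactor vector, so each cofactor is X^k times the previous one. -/
theorem rowCofactor_bidiagonal (j : Fin (d + 1)) :
    rowCofactor (bidiagonalPencil d k R) j = (-1) ^ d * X ^ ((j : ℕ) * k) := by
  induction j using Fin.induction with
  | zero => simp [rowCofactor_bidiagonal_zero]
  | succ i ih =>
    have h := congrFun (coeffPencil_mulVec_rowCofactor (bidiagonalPencil d k R)) i.succ
    rw [Pi.single_eq_of_ne (Fin.succ_ne_zero i)] at h
    simp only [Matrix.mulVec, dotProduct, coeffPencil_bidiagonal, sub_mul, ite_mul, zero_mul,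
      one_mul, Finset.sum_sub_distrib, Finset.sum_ite_eq', Finset.mem_univ, if_true] at h
    rw [← sub_eq_zero.1 h, ih, Fin.val_succ, Fin.val_castSucc]
    ring

/-- The index (a, 0) with a ≠ 0 would repeat the degree of (a - 1, k). This is the only collision,
and exactly these rows of `firstRowMatrix` are given to the constant terms. -/
theorem eq_and_eq_of_mul_add_eq_mul_add {a b j r : ℕ} (hb : b ≤ k) (hr : r ≤ k)
    (hab : b = 0 → a = 0) (hjr : r = 0 → j = 0) (h : a * k + b = j * k + r) : j = a ∧ r = b := by
  have aux : ∀ {a b j r : ℕ}, r ≤ k → (b = 0 → a = 0) → a * k + b = j * k + r → ¬ j < a := by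
    intro a b j r hr hab h hlt
    have h1 := Nat.mul_le_mul_right k (Nat.succ_le_of_lt hlt)
    have h2 : b ≠ 0 := fun hb => by have := hab hb; omega
    rw [Nat.succ_mul] at h1
    omega
  have h1 := aux hr hab h
  have h2 := aux hb hjr h.symm
  obtain rfl : j = a := by omega
  exact ⟨rfl, by omega⟩

/-- For a kernel vector the rows of constant terms give x (j, 0) = 0 for j ≠ 0. The cofactors being
± X^(jk), each other row then isolates a single unknown up to sign. -/
theorem det_firstRowMatrix_bidiagonal_ne_zero [IsDomain R] :
    (firstRowMatrix (bidiagonalPencil d k R)).det ≠ 0 := by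
  intro h0
  obtain ⟨x, hx, h⟩ := Matrix.exists_mulVec_eq_zero_iff.2 h0
  have h1 : ∀ p, (firstRowMatrix (bidiagonalPencil d k R)).mulVec x p = 0 := fun p => by
    rw [h]; rfl
  simp only [firstRowMatrix_mulVec, rowCofactor_bidiagonal] at h1
  have hz : ∀ j : Fin (d + 1), j ≠ 0 → x (j, 0) = 0 := fun j hj => by
    have := h1 (j, 0)
    rwa [if_pos ⟨rfl, hj⟩] at this
  refine hx (funext fun p => ?_)
  by_cases hp : p.2 = 0 ∧ p.1 ≠ 0
  · obtain ⟨a, b⟩ := p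
    obtain ⟨rfl, h2⟩ := hp
    exact hz _ h2
  have h2 := h1 p
  rw [if_neg hp, finsetSum_coeff] at h2
  have h3 : ∀ j : Fin (d + 1), ((∑ r : Fin (k + 1), C (x (j, r)) * X ^ (r : ℕ)) *
      ((-1) ^ d * X ^ ((j : ℕ) * k))).coeff (p.1 * k + p.2) =
      ∑ r : Fin (k + 1), if (j, r) = p then (-1) ^ d * x p else 0 := by
    intro j
    rw [Finset.sum_mul, finsetSum_coeff]
    refine Finset.sum_congr rfl fun r _ => ?_
    have h4 : C (x (j, r)) * X ^ (r : ℕ) * ((-1) ^ d * X ^ ((j : ℕ) * k)) =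
        C ((-1) ^ d * x (j, r)) * X ^ ((j : ℕ) * k + r) := by
      simp only [map_mul, map_pow, map_neg, map_one]; ring
    rw [h4, coeff_C_mul, coeff_X_pow]
    by_cases hjr : (j, r) = p
    · subst hjr; simp
    · rw [if_neg hjr]
      by_cases hj : r = 0 ∧ j ≠ 0
      · rw [hj.1, hz j hj.2]; simp
      · rw [if_neg, mul_zero]
        intro he
        apply hjr
        obtain ⟨a, b⟩ := p
        simp only at he hp
        have := eq_and_eq_of_mul_add_eq_mul_add (Nat.lt_succ_iff.1 b.2) (Nat.lt_succ_iff.1 r.2)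
          (fun h => by_contra fun h2 => hp ⟨Fin.ext h, fun h3 => h2 (by simp [h3])⟩)
          (fun h => by_contra fun h2 => hj ⟨Fin.ext h, fun h3 => h2 (by simp [h3])⟩) he
        rw [Fin.ext this.1, Fin.ext this.2]
  rw [Finset.sum_congr rfl fun j _ => h3 j] at h2
  rw [← Fintype.sum_prod_type (f := fun q => if q = p then (-1) ^ d * x p else 0)] at h2
  simpa using h2

end Bidiagonal

/-! ### Changing transcendence bases and specializing -/

section TranscendenceBasis

/-- Both families generate polynomial rings, isomorphic by v i ↦ w i, and `F` is an algebraic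
closure of each; the isomorphism extends. -/
theorem IsTranscendenceBasis.exists_ringEquiv {R F ι : Type*} [CommRing R] [Field F] [Algebra R F]
    [IsAlgClosed F] {v w : ι → F} (hv : IsTranscendenceBasis R v)
    (hw : IsTranscendenceBasis R w) : ∃ g : F ≃+* F, ∀ i, g (v i) = w i := by
  let _ := IsAlgClosed.isAlgClosure_of_transcendence_basis v hv
  let _ := IsAlgClosed.isAlgClosure_of_transcendence_basis w hw
  let e : Algebra.adjoin R (Set.range v) ≃+* Algebra.adjoin R (Set.range w) :=
    (hv.1.aevalEquiv.symm.trans hw.1.aevalEquiv).toRingEquiv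
  refine ⟨IsAlgClosure.equivOfEquiv F F e, fun i => ?_⟩
  have h1 : v i = algebraMap (Algebra.adjoin R (Set.range v)) F
      (hv.1.aevalEquiv (MvPolynomial.X i)) := by simp
  have h2 : w i = algebraMap (Algebra.adjoin R (Set.range w)) F
      (hw.1.aevalEquiv (MvPolynomial.X i)) := by simp
  rw [h1, IsAlgClosure.equivOfEquiv_algebraMap, h2]
  simp [e]

theorem IsTranscendenceBasis.of_mem_adjoin {F E ι κ : Type*} [Field F] [Field E] [Algebra F E]
    [Finite κ] {x : ι → E} (hx : IsTranscendenceBasis F x) {y : κ → E}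
    (hxy : ∀ i, x i ∈ IntermediateField.adjoin F (Set.range y)) (hcard : Nat.card κ = Nat.card ι)
    [Finite ι] :
    IsTranscendenceBasis F y := by
  have h1 := hx.isAlgebraic_field
  have hle : IntermediateField.adjoin F (Set.range x) ≤ IntermediateField.adjoin F (Set.range y) :=
    IntermediateField.adjoin_le_iff.2 (by rintro _ ⟨i, rfl⟩; exact hxy i)
  have h2 : Algebra.IsAlgebraic (IntermediateField.adjoin F (Set.range y)) E :=
    ⟨fun z => (h1.isAlgebraic z).tower_top_of_subalgebra_le hle⟩
  have h3 := IntermediateField.isAlgebraic_adjoin_iff_top.1 h2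
  refine Algebra.IsAlgebraic.isTranscendenceBasis_of_lift_le_trdeg_of_finite F y ?_
  have h4 := hx.lift_cardinalMk_eq_trdeg
  rw [← Nat.cast_card, Cardinal.lift_natCast, eq_comm, Cardinal.lift_eq_nat_iff] at h4
  rw [← Nat.cast_card, hcard, h4, Cardinal.lift_natCast, Cardinal.lift_natCast]

/-- Specialization principle: to show that an expression in generic quantities is nonzero, it
suffices to exhibit one point where it is. -/
theorem AlgebraicIndependent.aeval_ne_zero {F E L ι : Type*} [CommRing F] [CommRing E] [CommRing L]
    [Algebra F E] [Algebra F L] {x : ι → E} (hx : AlgebraicIndependent F x) {p : MvPolynomial ι F}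
    (z : ι → L) (h : MvPolynomial.aeval z p ≠ 0) : MvPolynomial.aeval x p ≠ 0 := fun h0 =>
  h (by rw [hx.eq_zero_of_aeval_eq_zero p h0, map_zero])

end TranscendenceBasis

theorem Matrix.exists_eq_of_map_mulVec_eq {ι F E : Type*} [Fintype ι] [DecidableEq ι] [Field F]
    [Field E] (f : F →+* E) {M : Matrix ι ι F} (hM : (M.map f).det ≠ 0) {x : ι → E} {b : ι → F}
    (h : (M.map f).mulVec x = f ∘ b) : ∃ y : ι → F, x = f ∘ y := by
  have hM' : IsUnit M.det := by
    rw [isUnit_iff_ne_zero]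
    intro h0
    rw [← RingHom.mapMatrix_apply, ← RingHom.map_det, h0, map_zero] at hM
    exact hM rfl
  refine ⟨M⁻¹.mulVec b, ?_⟩
  have h2 : (M.map f).mulVec (x - f ∘ (M⁻¹.mulVec b)) = 0 := by
    rw [Matrix.mulVec_sub, h, sub_eq_zero]
    funext i
    have := RingHom.map_mulVec f M (M⁻¹.mulVec b) i
    rw [Matrix.mulVec_mulVec, Matrix.mul_nonsing_inv _ hM', Matrix.one_mulVec] at this
    exact this
  exact sub_eq_zero.1 (Matrix.eq_zero_of_mulVec_eq_zero hM h2)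

/-! ### The roots of φ as free parameters -/

section GenericRoots

variable {d k : ℕ} {F : Type u} [Field F]

/-- The matrices whose entries are distinct indeterminates. -/
def indeterminateMatrices (n k : ℕ) :
    Fin (k + 1) → Matrix (Fin n) (Fin n) (MvPolynomial (Fin (k + 1) × Fin n × Fin n) ℚ) :=
  fun r => Matrix.of fun i j => MvPolynomial.X (r, i, j)

theorem indeterminateMatrices_map {n : ℕ} {L : Type*} [CommRing L] [Algebra ℚ L]
    (D : Fin (k + 1) → Matrix (Fin n) (Fin n) L) :
    (fun r => (indeterminateMatrices n k r).map
      (MvPolynomial.aeval (matrixEntries D) : _ →ₐ[ℚ] L).toRingHom) = D := by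
  funext r
  ext i j
  simp [indeterminateMatrices, matrixEntries]

theorem aeval_det_firstRowMatrix {L : Type*} [CommRing L] [Algebra ℚ L]
    (D : Fin (k + 1) → Matrix (Fin (d + 1)) (Fin (d + 1)) L) :
    MvPolynomial.aeval (matrixEntries D) (firstRowMatrix (indeterminateMatrices (d + 1) k)).det =
      (firstRowMatrix D).det := by
  conv_rhs => rw [← indeterminateMatrices_map D, firstRowMatrix_map]
  rw [← RingHom.mapMatrix_apply, ← RingHom.map_det]
  rfl

theorem det_firstRowMatrix_ne_zero [CharZero F]
    {B : Fin (k + 1) → Matrix (Fin (d + 1)) (Fin (d + 1)) F}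
    (hB : AlgebraicIndependent ℚ (matrixEntries B)) : (firstRowMatrix B).det ≠ 0 := by
  rw [← aeval_det_firstRowMatrix]
  refine hB.aeval_ne_zero (matrixEntries (bidiagonalPencil d k ℚ)) ?_
  rw [aeval_det_firstRowMatrix]
  exact det_firstRowMatrix_bidiagonal_ne_zero

theorem det_ne_zero_of_algebraicIndependent [CharZero F] {n : ℕ}
    {B : Fin (k + 1) → Matrix (Fin n) (Fin n) F}
    (hB : AlgebraicIndependent ℚ (matrixEntries B)) (r : Fin (k + 1)) : (B r).det ≠ 0 := by
  have key : ∀ {L : Type u} [CommRing L] [Algebra ℚ L] (D : Fin (k + 1) → Matrix (Fin n) (Fin n) L),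
      MvPolynomial.aeval (matrixEntries D) (indeterminateMatrices n k r).det = (D r).det := by
    intro L _ _ D
    conv_rhs => rw [← indeterminateMatrices_map D]
    rw [AlgHom.map_det]
    rfl
  rw [← key]
  refine hB.aeval_ne_zero (matrixEntries fun _ => (1 : Matrix (Fin n) (Fin n) F)) ?_
  rw [key, Matrix.det_one]
  exact one_ne_zero

/-- The indices of the parameters: the entries outside the first row, the constant terms of the
first row but the first, the leading coefficient of `φ`, and the roots of `φ`. -/
abbrev ParamIndex (d k m : ℕ) : Type :=
  (Fin (k + 1) × Fin d × Fin (d + 1)) ⊕ Fin d ⊕ Unit ⊕ Fin m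

/-- A transcendence basis adapted to the roots of `φ`. -/
def rootParams {R : Type*} {m : ℕ} (B : Fin (k + 1) → Matrix (Fin (d + 1)) (Fin (d + 1)) R) (c : R)
    (ev : Fin m → R) : ParamIndex d k m → R :=
  Sum.elim (fun p => B p.1 p.2.1.succ p.2.2)
    (Sum.elim (fun j => B 0 0 j.succ) (Sum.elim (fun _ => c) ev))

theorem firstRowMatrix_congr {R : Type*} [CommRing R]
    {A B : Fin (k + 1) → Matrix (Fin (d + 1)) (Fin (d + 1)) R}
    (h : ∀ r i j, A r (Fin.succ i) j = B r (Fin.succ i) j) :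
    firstRowMatrix A = firstRowMatrix B := by
  rw [firstRowMatrix, rowCofactor_congr h]
  rfl

/-- The first row is the unique solution of a linear system whose matrix and right-hand side lie in
the field generated by the parameters. -/
theorem entry_mem_adjoin_rootParams [CharZero F] {m : ℕ}
    {B : Fin (k + 1) → Matrix (Fin (d + 1)) (Fin (d + 1)) F}
    (hB : (firstRowMatrix B).det ≠ 0) {c : F} {ev : Fin m → F}
    (hdet : (coeffPencil B).det = C c * ∏ i, (X - C (ev i)))
    (p : Fin (k + 1) × Fin (d + 1) × Fin (d + 1)) :
    matrixEntries B p ∈ IntermediateField.adjoin ℚ (Set.range (rootParams B c ev)) := by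
  set E := IntermediateField.adjoin ℚ (Set.range (rootParams B c ev)) with hE
  have hmem : ∀ i, rootParams B c ev i ∈ E := fun i =>
    IntermediateField.subset_adjoin _ _ ⟨i, rfl⟩
  have hrow : ∀ r i j, B r (Fin.succ i) j ∈ E := fun r i j => hmem (Sum.inl (r, i, j))
  have hext : ∀ j : Fin d, B 0 0 j.succ ∈ E := fun j => hmem (Sum.inr (Sum.inl j))
  have hc : c ∈ E := hmem (Sum.inr (Sum.inr (Sum.inl ())))
  have hev : ∀ i, ev i ∈ E := fun i => hmem (Sum.inr (Sum.inr (Sum.inr i)))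
  let f : E →+* F := algebraMap E F
  let B' : Fin (k + 1) → Matrix (Fin (d + 1)) (Fin (d + 1)) E :=
    fun r => Matrix.of (Fin.cons 0 fun i j => ⟨B r (Fin.succ i) j, hrow r i j⟩)
  have hM : firstRowMatrix B = (firstRowMatrix B').map f := by
    rw [← firstRowMatrix_map]
    exact firstRowMatrix_congr fun r i j => rfl
  let q : Polynomial E := C ⟨c, hc⟩ * ∏ i, (X - C ⟨ev i, hev i⟩)
  have hq : (coeffPencil B).det = q.map f := by
    rw [hdet]
    simp [q, Polynomial.map_prod, f]
  let b : Fin (d + 1) × Fin (k + 1) → E := fun p =>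
    if p.2 = 0 ∧ p.1 ≠ 0 then (Fin.cases 0 (fun j => ⟨B 0 0 j.succ, hext j⟩) p.1 : E) else
      q.coeff (p.1 * k + p.2)
  have hb : (firstRowMatrix B).mulVec (fun q => B q.2 0 q.1) = f ∘ b := by
    funext p
    rw [firstRowMatrix_mulVec_firstRow, hq, Function.comp_apply]
    by_cases hp : p.2 = 0 ∧ p.1 ≠ 0
    · obtain ⟨j, hj⟩ := Fin.exists_succ_eq.2 hp.2
      simp only [b, if_pos hp]
      rw [← hj]
      rfl
    · simp only [b, if_neg hp, coeff_map]
  rw [hM] at hb hB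
  obtain ⟨y, hy⟩ := Matrix.exists_eq_of_map_mulVec_eq f hB hb
  obtain ⟨r, i, j⟩ := p
  refine Fin.cases ?_ (fun i => hrow r i j) i
  have := congrFun hy (j, r)
  change B r 0 j ∈ E
  simp only at this
  rw [this]
  exact (y (j, r)).2

/-- The parameters generate all entries and are equally numerous: (k+1)d(d+1) + d + 1 + k(d+1) =
(k+1)(d+1)². -/
theorem isTranscendenceBasis_rootParams [CharZero F]
    {B : Fin (k + 1) → Matrix (Fin (d + 1)) (Fin (d + 1)) F}
    (hB : IsTranscendenceBasis ℚ (matrixEntries B)) {c : F} {ev : Fin (k * (d + 1)) → F}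
    (hdet : (coeffPencil B).det = C c * ∏ i, (X - C (ev i))) :
    IsTranscendenceBasis ℚ (rootParams B c ev) := by
  refine hB.of_mem_adjoin (entry_mem_adjoin_rootParams (det_firstRowMatrix_ne_zero hB.1) hdet) ?_
  simp only [Nat.card_eq_fintype_card, Fintype.card_sum, Fintype.card_prod, Fintype.card_fin,
    Fintype.card_unit]
  ring

/-- Permuting the roots in the parameter family gives another transcendence basis for the same
matrices. The automorphism relating the two preserves φ, so the first row and its image solve the
same invertible linear system. -/
theorem exists_ringEquiv_permuting_roots [CharZero F] [IsAlgClosed F]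
    {B : Fin (k + 1) → Matrix (Fin (d + 1)) (Fin (d + 1)) F}
    (hB : IsTranscendenceBasis ℚ (matrixEntries B)) {c : F} {ev : Fin (k * (d + 1)) → F}
    (hdet : (coeffPencil B).det = C c * ∏ i, (X - C (ev i)))
    (σ : Equiv.Perm (Fin (k * (d + 1)))) :
    ∃ g : F ≃+* F, (∀ r i j, g (B r i j) = B r i j) ∧ ∀ i, g (ev i) = ev (σ i) := by
  have hdet' : (coeffPencil B).det = C c * ∏ i, (X - C ((ev ∘ σ) i)) := by
    rw [hdet]
    congr 1
    exact (Equiv.prod_comp σ fun i => X - C (ev i)).symm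
  obtain ⟨g, hg⟩ := (isTranscendenceBasis_rootParams hB hdet).exists_ringEquiv
    (isTranscendenceBasis_rootParams hB hdet')
  have hrow : ∀ r i j, g (B r (Fin.succ i) j) = B r (Fin.succ i) j :=
    fun r i j => hg (Sum.inl (r, i, j))
  have hext : ∀ j : Fin d, g (B 0 0 j.succ) = B 0 0 j.succ := fun j => hg (Sum.inr (Sum.inl j))
  have hc : g c = c := hg (Sum.inr (Sum.inr (Sum.inl ())))
  have hev : ∀ i, g (ev i) = ev (σ i) := fun i => hg (Sum.inr (Sum.inr (Sum.inr i)))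
  refine ⟨g, ?_, hev⟩
  let f : F →+* F := g
  let B' : Fin (k + 1) → Matrix (Fin (d + 1)) (Fin (d + 1)) F := fun r => (B r).map f
  have hM : firstRowMatrix B' = firstRowMatrix B := firstRowMatrix_congr hrow
  have hD : (coeffPencil B').det = (coeffPencil B).det := by
    rw [coeffPencil_map, ← RingHom.mapMatrix_apply, ← RingHom.map_det, hdet, coe_mapRingHom]
    conv_rhs => rw [← hdet, hdet']
    simp [Polynomial.map_prod, f, hc, hev]
  have hx : (fun q : Fin (d + 1) × Fin (k + 1) => B' q.2 0 q.1) = fun q => B q.2 0 q.1 := by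
    refine sub_eq_zero.1 (Matrix.eq_zero_of_mulVec_eq_zero (det_firstRowMatrix_ne_zero hB.1) ?_)
    rw [Matrix.mulVec_sub, sub_eq_zero]
    conv_lhs => rw [← hM]
    funext p
    rw [firstRowMatrix_mulVec_firstRow, firstRowMatrix_mulVec_firstRow, hD]
    split_ifs with hp
    · obtain ⟨j, hj⟩ := Fin.exists_succ_eq.2 hp.2
      rw [← hj]
      exact hext j
    · rfl
  intro r i j
  refine Fin.cases ?_ (fun i => hrow r i j) i
  exact congrFun hx (j, r)

/-- Matrices with zero first row, whose other entries are distinct indeterminates. -/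
def indeterminateRows (d k m : ℕ) :
    Fin (k + 1) → Matrix (Fin (d + 1)) (Fin (d + 1)) (MvPolynomial (ParamIndex d k m) ℚ) :=
  fun r => Matrix.of (Fin.cons 0 fun i j => MvPolynomial.X (Sum.inl (r, i, j)))

theorem aeval_eval_rowCofactor {m : ℕ} {L : Type*} [CommRing L] [Algebra ℚ L]
    (D : Fin (k + 1) → Matrix (Fin (d + 1)) (Fin (d + 1)) L) (c : L) (e : Fin m → L)
    (j : Fin (d + 1)) (i : Fin m) :
    MvPolynomial.aeval (rootParams D c e) ((rowCofactor (indeterminateRows d k m) j).eval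
      (MvPolynomial.X (Sum.inr (Sum.inr (Sum.inr i))))) = (rowCofactor D j).eval (e i) := by
  let f := (MvPolynomial.aeval (R := ℚ) (rootParams D c e)).toRingHom
  have h : rowCofactor D = rowCofactor fun r => (indeterminateRows d k m r).map f := by
    refine rowCofactor_congr fun r i j => ?_
    simp [indeterminateRows, f, rootParams]
  have h2 : f (MvPolynomial.X (Sum.inr (Sum.inr (Sum.inr i)))) = e i := by
    simp [f, rootParams]
  rw [h, rowCofactor_map, ← h2, eval_map, eval₂_at_apply]
  rfl

/-- The columns are the cofactor vectors at the chosen roots, which span the kernels of the pencil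
there; this puts the eigenvectors in general position. -/
theorem det_eval_rowCofactor_ne_zero [CharZero F] {m : ℕ} (hk : k ≠ 0)
    {B : Fin (k + 1) → Matrix (Fin (d + 1)) (Fin (d + 1)) F} {c : F} {ev : Fin m → F}
    (h : AlgebraicIndependent ℚ (rootParams B c ev)) (J : Fin (d + 1) ↪ Fin m) :
    (Matrix.of fun j b => (rowCofactor B j).eval (ev (J b))).det ≠ 0 := by
  have key : ∀ {L : Type u} [CommRing L] [Algebra ℚ L]
      (D : Fin (k + 1) → Matrix (Fin (d + 1)) (Fin (d + 1)) L) (c : L) (e : Fin m → L),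
      MvPolynomial.aeval (rootParams D c e) (Matrix.of fun j b =>
        (rowCofactor (indeterminateRows d k m) j).eval
          (MvPolynomial.X (Sum.inr (Sum.inr (Sum.inr (J b)))))).det =
      (Matrix.of fun j b => (rowCofactor D j).eval (e (J b))).det := by
    intro L _ _ D c e
    rw [AlgHom.map_det]
    congr 1
    ext1 j b
    exact aeval_eval_rowCofactor D c e j (J b)
  rw [← key B c ev]
  -- At the bidiagonal pencil with the values 0, 1, 2, … for the roots, the matrix is up to sign a
  -- transposed Vandermonde matrix in k-th powers, distinct since k ≠ 0. The parameter c does not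
  -- occur, so its value 0 is arbitrary.
  refine h.aeval_ne_zero (rootParams (bidiagonalPencil d k F) 0 fun i => ((i : ℕ) : F)) ?_
  rw [key]
  have h2 : (Matrix.of fun j b => (rowCofactor (bidiagonalPencil d k F) j).eval
      (((J b : Fin m) : ℕ) : F)) =
        (-1 : F) ^ d • (Matrix.vandermonde fun b => (((J b : Fin m) : ℕ) : F) ^ k).transpose := by
    ext j b
    simp only [rowCofactor_bidiagonal, Matrix.of_apply, Matrix.smul_apply, Matrix.transpose_apply,
      Matrix.vandermonde_apply, eval_mul, eval_pow, eval_neg, eval_one, eval_X, smul_eq_mul]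
    ring
  rw [h2, Matrix.det_smul, Matrix.det_transpose]
  refine mul_ne_zero (by simp) (Matrix.det_vandermonde_ne_zero_iff.2 fun a b hab => ?_)
  have hab : (((J a : Fin m) : ℕ) : F) ^ k = (((J b : Fin m) : ℕ) : F) ^ k := hab
  have hab : ((J a : Fin m) : ℕ) ^ k = ((J b : Fin m) : ℕ) ^ k := by exact_mod_cast hab
  exact J.injective (Fin.ext (Nat.pow_left_injective hk hab))

end GenericRoots

/-- Let N be M with row i replaced by the j-th unit vector. Then N v = v j • e_i; multiply by the
adjugate of N, whose i-th column is that of the adjugate of M, while det N is its (j, i) entry. It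
follows that kernel vectors are proportional to a nonzero cofactor column. -/
theorem Matrix.adjugate_smul_eq {ι R : Type*} [Fintype ι] [DecidableEq ι] [CommRing R]
    (M : Matrix ι ι R) {v : ι → R} {i : ι} (h : ∀ a ≠ i, M.mulVec v a = 0) (j : ι) :
    M.adjugate j i • v = v j • fun a => M.adjugate a i := by
  let N := M.updateRow i (Pi.single j 1)
  have h1 : N.mulVec v = v j • Pi.single i 1 := by
    funext a
    by_cases ha : a = i
    · subst ha
      simp [N, Matrix.mulVec, single_dotProduct]
    · have h0 : N.mulVec v a = M.mulVec v a := by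
        simp only [N, Matrix.mulVec, Matrix.updateRow_ne ha]
      rw [h0, h a ha]
      simp [ha]
  have h2 := congrArg N.adjugate.mulVec h1
  rw [Matrix.mulVec_mulVec, Matrix.adjugate_mul, Matrix.smul_mulVec, Matrix.one_mulVec,
    Matrix.mulVec_smul] at h2
  rw [Matrix.adjugate_apply]
  refine h2.trans ?_
  congr 1
  funext a
  rw [Matrix.mulVec_single_one, Matrix.col_apply, Matrix.adjugate_apply, Matrix.adjugate_apply]
  simp only [N, Matrix.updateRow_idem]

/-! ### Generic matrices have a generic eigensystem -/

section GenericEquation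

variable {n d k : ℕ} {K : Type*} [Field K] {Ω : Type*} [Field Ω] [Algebra K Ω]

theorem matrixPencil_X (A : Fin (k + 1) → Matrix (Fin n) (Fin n) K) :
    matrixPencil A (X : Polynomial Ω) = coeffPencil fun r => (A r).map (algebraMap K Ω) := by
  ext1 i j
  simp only [matrixPencil, coeffPencil, Matrix.sum_apply, Matrix.smul_apply, Matrix.map_apply,
    Matrix.of_apply, smul_eq_mul]
  exact Finset.sum_congr rfl fun r _ => mul_comm _ _

theorem pencilDet_map_eq_det (A : Fin (k + 1) → Matrix (Fin n) (Fin n) K) :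
    (pencilDet A).map (algebraMap K Ω) =
      (coeffPencil fun r => (A r).map (algebraMap K Ω)).det := by
  rw [pencilDet_map, matrixPencil_X]

theorem matrixPencil_eq_map (A : Fin (k + 1) → Matrix (Fin n) (Fin n) K) (μ : Ω) :
    matrixPencil A μ =
      (coeffPencil fun r => (A r).map (algebraMap K Ω)).map (Polynomial.evalRingHom μ) := by
  have := matrixPencil_map A ((Polynomial.aeval μ : Polynomial Ω →ₐ[Ω] Ω).restrictScalars K) X
  rw [AlgHom.restrictScalars_apply, aeval_X, matrixPencil_X] at this
  rw [this]
  ext i j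
  simp [coe_aeval_eq_eval]

/-- The vector of cofactors along the first row of `A(μ)`. -/
def cofactorVector (A : Fin (k + 1) → Matrix (Fin (d + 1)) (Fin (d + 1)) K) (μ : Ω) :
    Fin (d + 1) → Ω :=
  fun j => (rowCofactor (fun r => (A r).map (algebraMap K Ω)) j).eval μ

variable {A : Fin (k + 1) → Matrix (Fin (d + 1)) (Fin (d + 1)) K}

theorem cofactorVector_eq_adjugate (μ : Ω) (j : Fin (d + 1)) :
    cofactorVector A μ j = (matrixPencil A μ).adjugate j 0 := by
  rw [matrixPencil_eq_map, ← RingHom.mapMatrix_apply, ← RingHom.map_adjugate]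
  rfl

theorem exists_eq_smul_cofactorVector {μ : Ω} (hw : cofactorVector A μ ≠ 0) {v : Fin (d + 1) → Ω}
    (hv : (matrixPencil A μ).mulVec v = 0) : ∃ t : Ω, v = t • cofactorVector A μ := by
  obtain ⟨j, hj⟩ := Function.ne_iff.1 hw
  have h := Matrix.adjugate_smul_eq (matrixPencil A μ) (i := 0)
    (fun a _ => congrFun hv a) j
  simp only [← cofactorVector_eq_adjugate] at h
  refine ⟨(cofactorVector A μ j)⁻¹ * v j, ?_⟩
  rw [mul_smul]
  refine (inv_smul_smul₀ hj v).symm.trans ?_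
  rw [h]

theorem isTranscendenceBasis_matrixEntries [CharZero K] [CharZero Ω] [Algebra.IsAlgebraic K Ω]
    {A : Fin (k + 1) → Matrix (Fin n) (Fin n) K} (hA : AreGenericMatrices A)
    (hK : IntermediateField.adjoin ℚ (Set.range (matrixEntries A)) = ⊤) :
    IsTranscendenceBasis ℚ (matrixEntries fun r => (A r).map (algebraMap K Ω)) := by
  have h1 : Algebra.IsAlgebraic (IntermediateField.adjoin ℚ (Set.range (matrixEntries A))) K :=
    ⟨fun x => isAlgebraic_algebraMap
      (⟨x, by rw [hK]; trivial⟩ : IntermediateField.adjoin ℚ (Set.range (matrixEntries A)))⟩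
  have h2 : IsTranscendenceBasis ℚ (matrixEntries A) :=
    isTranscendenceBasis_iff_algebraicIndependent_isAlgebraic.2
      ⟨hA, IntermediateField.isAlgebraic_adjoin_iff_top.1 h1⟩
  exact h2.algebraMap_comp

theorem natDegree_pencilDet {A : Fin (k + 1) → Matrix (Fin n) (Fin n) K}
    (h : (A (Fin.last k)).det ≠ 0) : (pencilDet A).natDegree = k * n := by
  have h1 : pencilDet A = (coeffPencil A).det := by
    have := pencilDet_map_eq_det (Ω := K) A
    simpa using this
  refine le_antisymm (h1 ▸ natDegree_det_coeffPencil_le A) (le_natDegree_of_ne_zero ?_)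
  rwa [h1, coeff_det_coeffPencil]

theorem exists_eq_C_mul_prod [IsAlgClosed Ω] {p : Polynomial Ω} {m : ℕ} (hp : p.natDegree = m) :
    ∃ ev : Fin m → Ω, p = C p.leadingCoeff * ∏ i, (X - C (ev i)) := by
  subst hp
  have hs := IsAlgClosed.splits p
  have hc := hs.natDegree_eq_card_roots
  have hl : p.natDegree = p.roots.toList.length := by rw [Multiset.length_toList, hc]
  refine ⟨fun i => p.roots.toList.get (i.cast hl), ?_⟩
  conv_lhs => rw [hs.eq_prod_roots]
  congr 1
  conv_lhs => rw [← Multiset.coe_toList p.roots]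
  rw [Multiset.map_coe, Multiset.prod_coe, ← List.prod_ofFn]
  congr 1
  refine List.ext_get (by simp [hc]) fun i h1 h2 => ?_
  simp

theorem rootSet_eq_range {p : K[X]} (hp : p ≠ 0) {m : ℕ} {c : Ω} {e : Fin m → Ω}
    (he : p.map (algebraMap K Ω) = C c * ∏ i, (X - C (e i))) : p.rootSet Ω = Set.range e := by
  have hc : c ≠ 0 := by
    rintro rfl
    rw [C_0, zero_mul, Polynomial.map_eq_zero] at he
    exact hp he
  ext x
  rw [Polynomial.mem_rootSet, ← eval_map_algebraMap, he, eval_mul, eval_prod, eval_C, mul_eq_zero,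
    Finset.prod_eq_zero_iff]
  simp [hp, hc, sub_eq_zero, eq_comm (a := x)]

variable [CharZero Ω] [IsAlgClosed Ω]

/-- The roots belong to an algebraically independent family, and such a family has no repetitions;
no discriminant is needed. -/
theorem exists_injective_roots (hk : k ≠ 0)
    (hB : IsTranscendenceBasis ℚ (matrixEntries fun r => (A r).map (algebraMap K Ω)))
    (hdeg : (pencilDet A).natDegree = k * (d + 1)) :
    ∃ e : Fin (k * (d + 1)) → Ω, Function.Injective e ∧ Set.range e = (pencilDet A).rootSet Ω ∧
      (pencilDet A).map (algebraMap K Ω) =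
        C (algebraMap K Ω (pencilDet A).leadingCoeff) * ∏ i, (X - C (e i)) := by
  obtain ⟨e, he⟩ := exists_eq_C_mul_prod (p := (pencilDet A).map (algebraMap K Ω))
    (m := k * (d + 1)) (by rw [natDegree_map, hdeg])
  rw [leadingCoeff_map] at he
  have h0 : pencilDet A ≠ 0 := by
    rintro h
    rw [h, natDegree_zero] at hdeg
    exact mul_ne_zero hk (Nat.succ_ne_zero d) hdeg.symm
  refine ⟨e, ?_, (rootSet_eq_range h0 he).symm, he⟩
  rw [pencilDet_map_eq_det] at he
  exact ((isTranscendenceBasis_rootParams hB he).1.injective).comp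
      (Sum.inr_injective.comp (Sum.inr_injective.comp Sum.inr_injective))

theorem pencilDet_eq_C_mul_prod (hk : k ≠ 0)
    (hB : IsTranscendenceBasis ℚ (matrixEntries fun r => (A r).map (algebraMap K Ω)))
    (hdeg : (pencilDet A).natDegree = k * (d + 1)) {ev : Fin (k * (d + 1)) → Ω}
    (hev : Function.Injective ev) (hrange : Set.range ev = (pencilDet A).rootSet Ω) :
    (coeffPencil fun r => (A r).map (algebraMap K Ω)).det =
      C (algebraMap K Ω (pencilDet A).leadingCoeff) * ∏ i, (X - C (ev i)) := by
  classical
  obtain ⟨e, hei, hr, he⟩ := exists_injective_roots hk hB hdeg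
  have hi : Finset.univ.image ev = Finset.univ.image e := by
    apply Finset.coe_injective
    simp [hrange, hr]
  rw [← pencilDet_map_eq_det, he, ← Finset.prod_image (f := fun x => X - C x) hev.injOn, hi,
    Finset.prod_image hei.injOn]

/-- Each given eigenvector is a nonzero multiple of the cofactor vector, so P_J is the invertible
cofactor matrix times an invertible diagonal one. -/
theorem isGenericEigensystem (hk : k ≠ 0)
    (hB : IsTranscendenceBasis ℚ (matrixEntries fun r => (A r).map (algebraMap K Ω)))
    (hdeg : (pencilDet A).natDegree = k * (d + 1)) {ev : Fin (k * (d + 1)) → Ω}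
    (hev : Function.Injective ev) (hrange : Set.range ev = (pencilDet A).rootSet Ω)
    {u : Fin (k * (d + 1)) → Fin (d + 1) → Ω} (hu : ∀ i, u i ≠ 0)
    (hu0 : ∀ i, (matrixPencil A (ev i)).mulVec (u i) = 0) : IsGenericEigensystem A ev u := by
  have hdet := pencilDet_eq_C_mul_prod hk hB hdeg hev hrange
  have h0 : pencilDet A ≠ 0 := by
    rintro h
    rw [h, natDegree_zero] at hdeg
    exact mul_ne_zero hk (Nat.succ_ne_zero d) hdeg.symm
  have hP := fun J : Fin (d + 1) ↪ Fin (k * (d + 1)) =>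
    det_eval_rowCofactor_ne_zero hk (isTranscendenceBasis_rootParams hB hdet).1 J
  have hw : ∀ i, cofactorVector A (ev i) ≠ 0 := by
    intro i hi
    have hle : d + 1 ≤ k * (d + 1) := Nat.le_mul_of_pos_left _ (Nat.pos_of_ne_zero hk)
    -- The transposition places the root i in column 0, so a zero cofactor vector would make an
    -- invertible matrix singular.
    let J : Fin (d + 1) ↪ Fin (k * (d + 1)) :=
      (Fin.castLEEmb hle).trans (Equiv.swap (Fin.castLE hle 0) i).toEmbedding
    refine hP J (Matrix.det_eq_zero_of_column_eq_zero 0 fun j => ?_)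
    have hJ : J 0 = i := by simp [J]
    rw [Matrix.of_apply, hJ]
    exact congrFun hi j
  choose s hs using fun i => exists_eq_smul_cofactorVector (hw i) (hu0 i)
  have hs0 : ∀ i, s i ≠ 0 := fun i h => hu i (by rw [hs i, h, zero_smul])
  refine ⟨?_, hev, hrange, hu, hu0, fun i v hv => ?_, fun J => ?_⟩
  · rw [pencilDet_map_eq_det, hdet]
    exact (separable_prod_X_sub_C_iff.2 hev).unit_mul (isUnit_C.2 (isUnit_iff_ne_zero.2 (by simpa)))
  · obtain ⟨t, ht⟩ := exists_eq_smul_cofactorVector (hw i) hv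
    refine ⟨t / s i, ?_⟩
    rw [hs i, smul_smul, div_mul_cancel₀ _ (hs0 i), ht]
  · have h : eigenvectorMatrix u J = (Matrix.of fun j b =>
        (rowCofactor (fun r => (A r).map (algebraMap K Ω)) j).eval (ev (J b))) *
          Matrix.diagonal fun b => s (J b) := by
      ext j b
      rw [Matrix.mul_diagonal, eigenvectorMatrix, Matrix.of_apply, hs (J b)]
      exact mul_comm _ _
    rw [h, Matrix.det_mul, Matrix.det_diagonal, isUnit_iff_ne_zero]
    exact mul_ne_zero (hP J.toEmbedding) (Finset.prod_ne_zero_iff.2 fun b _ => hs0 _)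

theorem exists_isGenericEigensystem (hk : k ≠ 0)
    (hB : IsTranscendenceBasis ℚ (matrixEntries fun r => (A r).map (algebraMap K Ω)))
    (hdeg : (pencilDet A).natDegree = k * (d + 1)) :
    ∃ (ev : Fin (k * (d + 1)) → Ω) (u : Fin (k * (d + 1)) → Fin (d + 1) → Ω),
      IsGenericEigensystem A ev u := by
  obtain ⟨e, hei, hr, he⟩ := exists_injective_roots hk hB hdeg
  have hroot : ∀ i, aeval (e i) (pencilDet A) = 0 := fun i =>
    aeval_eq_zero_of_mem_rootSet (hr ▸ Set.mem_range_self i)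
  have hex : ∀ i, ∃ v ≠ 0, (matrixPencil A (e i)).mulVec v = 0 := fun i => by
    rw [Matrix.exists_mulVec_eq_zero_iff, ← aeval_pencilDet, hroot]
  choose u hu hu0 using hex
  exact ⟨e, u, isGenericEigensystem hk hB hdeg hei hr hu hu0⟩

end GenericEquation

/-! ### Galois group and fields of definition -/

section GaloisAction

variable {K : Type*} [Field K] {Ω : Type*} [Field Ω] [Algebra K Ω]

theorem IntermediateField.mem_of_forall_algEquiv [IsGalois K Ω] {L : IntermediateField K Ω} {x : Ω}
    (h : ∀ g : Ω ≃ₐ[K] Ω, (∀ y ∈ L, g y = y) → g x = x) : x ∈ L := by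
  rw [← InfiniteGalois.fixedField_fixingSubgroup L, IntermediateField.mem_fixedField_iff]
  exact fun g hg => h g ((IntermediateField.mem_fixingSubgroup_iff L g).1 hg)

theorem Polynomial.Gal.nonempty_mulEquiv_perm [IsAlgClosed Ω] {p : K[X]} {m : ℕ} {ev : Fin m → Ω}
    (hev : Function.Injective ev) (hrange : Set.range ev = p.rootSet Ω)
    (h : ∀ σ : Equiv.Perm (Fin m), ∃ g : Ω ≃ₐ[K] Ω, ∀ i, g (ev i) = ev (σ i)) :
    Nonempty (p.Gal ≃* Equiv.Perm (Fin m)) := by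
  have : Fact ((p.map (algebraMap K Ω)).Splits) := ⟨IsAlgClosed.splits _⟩
  let e : Fin m ≃ p.rootSet Ω := (Equiv.ofInjective ev hev).trans (Equiv.setCongr hrange)
  have he : ∀ i, (e i : Ω) = ev i := fun i => rfl
  have hsurj : Function.Surjective (Polynomial.Gal.galActionHom p Ω) := by
    intro τ
    obtain ⟨g, hg⟩ := h ((e.trans τ).trans e.symm)
    refine ⟨Polynomial.Gal.restrict p Ω g, Equiv.ext fun x => Subtype.ext ?_⟩
    rw [Polynomial.Gal.galActionHom_restrict]
    obtain ⟨i, rfl⟩ := e.surjective x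
    rw [he, hg, ← he]
    simp
  exact ⟨(MulEquiv.ofBijective _ ⟨Polynomial.Gal.galActionHom_injective p Ω, hsurj⟩).trans
    e.symm.permCongrHom⟩

/-- By transitivity the minimal polynomial of one root vanishes at all m roots, so its degree is at
least that of p. -/
theorem Polynomial.irreducible_of_forall_perm {p : K[X]} {m : ℕ} (hm : m ≠ 0) {ev : Fin m → Ω}
    (hp : p.natDegree = m)
    (hev : Function.Injective ev) (hrange : Set.range ev = p.rootSet Ω)
    (h : ∀ σ : Equiv.Perm (Fin m), ∃ g : Ω ≃ₐ[K] Ω, ∀ i, g (ev i) = ev (σ i)) :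
    Irreducible p := by
  classical
  have hp0 : p ≠ 0 := by rintro rfl; exact hm (by simpa using hp.symm)
  have hroot : ∀ i, aeval (ev i) p = 0 := fun i =>
    aeval_eq_zero_of_mem_rootSet (hrange ▸ Set.mem_range_self i)
  let i₀ : Fin m := ⟨0, Nat.pos_of_ne_zero hm⟩
  have hint : IsIntegral K (ev i₀) := IsAlgebraic.isIntegral ⟨p, hp0, hroot _⟩
  have hq0 := minpoly.ne_zero hint
  have hroot' : ∀ i, aeval (ev i) (minpoly K (ev i₀)) = 0 := by
    intro i
    obtain ⟨g, hg⟩ := h (Equiv.swap i₀ i)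
    have := hg i₀
    rw [Equiv.swap_apply_left] at this
    rw [← this, aeval_algHom_apply g, minpoly.aeval, map_zero]
  have hcard : m ≤ (minpoly K (ev i₀)).natDegree := by
    have h1 : Finset.univ.image ev ⊆ ((minpoly K (ev i₀)).aroots Ω).toFinset := by
      intro x hx
      obtain ⟨i, -, rfl⟩ := Finset.mem_image.1 hx
      rw [Multiset.mem_toFinset, mem_aroots]
      exact ⟨hq0, hroot' i⟩
    have h2 := Finset.card_le_card h1
    rw [Finset.card_image_of_injective _ hev, Finset.card_univ, Fintype.card_fin] at h2
    refine h2.trans ((Multiset.toFinset_card_le _).trans ?_)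
    rw [aroots_def]
    exact (card_roots' _).trans natDegree_map_le
  have hass := associated_of_dvd_of_natDegree_le (minpoly.dvd K _ (hroot i₀)) hp0 (hp ▸ hcard)
  exact hass.irreducible (minpoly.irreducible hint)

/-- K is generated over ℚ by the entries, so a ring automorphism of Ω fixing them is K-linear. -/
theorem exists_algEquiv_permuting_roots {d k : ℕ} [CharZero K] [CharZero Ω] [IsAlgClosed Ω]
    (hk : k ≠ 0) {A : Fin (k + 1) → Matrix (Fin (d + 1)) (Fin (d + 1)) K}
    (hK : IntermediateField.adjoin ℚ (Set.range (matrixEntries A)) = ⊤)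
    (hB : IsTranscendenceBasis ℚ (matrixEntries fun r => (A r).map (algebraMap K Ω)))
    (hdeg : (pencilDet A).natDegree = k * (d + 1)) {ev : Fin (k * (d + 1)) → Ω}
    (hev : Function.Injective ev) (hrange : Set.range ev = (pencilDet A).rootSet Ω)
    (σ : Equiv.Perm (Fin (k * (d + 1)))) :
    ∃ g : Ω ≃ₐ[K] Ω, ∀ i, g (ev i) = ev (σ i) := by
  obtain ⟨g, hg, hgev⟩ := exists_ringEquiv_permuting_roots hB
    (pencilDet_eq_C_mul_prod hk hB hdeg hev hrange) σ
  refine ⟨AlgEquiv.ofRingEquiv (f := g) fun x => ?_, hgev⟩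
  have hx : x ∈ IntermediateField.adjoin ℚ (Set.range (matrixEntries A)) := by rw [hK]; trivial
  induction hx using IntermediateField.adjoin_induction with
  | mem x hx => obtain ⟨p, rfl⟩ := hx; exact hg _ _ _
  | algebraMap q => simp
  | add x y _ _ hx hy => rw [map_add, map_add, hx, hy]
  | inv x _ hx => rw [map_inv₀, map_inv₀, hx]
  | mul x y _ _ hx hy => rw [map_mul, map_mul, hx, hy]

theorem map_mem_unilateralSolutions {n k : ℕ} {A : Fin (k + 1) → Matrix (Fin n) (Fin n) K}
    (g : Ω ≃ₐ[K] Ω) {X₀ : Matrix (Fin n) (Fin n) Ω} (hX : X₀ ∈ unilateralSolutions A Ω) :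
    X₀.map g ∈ unilateralSolutions A Ω := by
  have := unilateral_map A g.toAlgHom X₀
  rw [show unilateral A X₀ = 0 from hX, Matrix.map_zero _ (map_zero _)] at this
  exact this

namespace IsGenericEigensystem

variable {n k m : ℕ} {A : Fin (k + 1) → Matrix (Fin n) (Fin n) K}
  {ev : Fin m → Ω} {u : Fin m → Fin n → Ω}

/-- The image is again a solution, with the same characteristic polynomial, and that polynomial
determines the solution. -/
theorem map_algEquiv_eq_self [IsAlgClosed Ω] (H : IsGenericEigensystem A ev u) {g : Ω ≃ₐ[K] Ω}
    (hg : ∀ i, g (ev i) = ev i) {X₀ : Matrix (Fin n) (Fin n) Ω}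
    (hX : X₀ ∈ unilateralSolutions A Ω) : X₀.map g = X₀ := by
  refine H.eq_of_charpoly_eq (map_mem_unilateralSolutions g hX) hX ?_
  have h := Matrix.charpoly_map X₀ (g : Ω →+* Ω)
  obtain ⟨J, rfl⟩ := H.exists_eq_solutionOfSubset hX
  refine h.trans ?_
  rw [charpoly_solutionOfSubset ev (H.isUnit_det J), Polynomial.map_prod]
  refine Finset.prod_congr rfl fun b _ => ?_
  simp [hg]

/-- If g moved the root i to i', take an n-subset containing i but not i', which exists since 0 < n
< m. Its solution, being fixed by g, would have the root i' as an eigenvalue. -/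
theorem algEquiv_apply_eq_self (H : IsGenericEigensystem A ev u) (hn : n ≠ 0) (hnm : n < m)
    {g : Ω ≃ₐ[K] Ω} (hg : ∀ X₀ ∈ unilateralSolutions A Ω, X₀.map g = X₀) (i : Fin m) :
    g (ev i) = ev i := by
  have hi : g (ev i) ∈ Set.range ev := by
    rw [H.range_eq, mem_rootSet]
    have hi : ev i ∈ (pencilDet A).rootSet Ω := H.range_eq ▸ Set.mem_range_self i
    rw [mem_rootSet] at hi
    exact ⟨hi.1, by rw [aeval_algHom_apply g, hi.2, map_zero]⟩
  obtain ⟨i', hi'⟩ := hi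
  rw [← hi']
  by_contra hne
  have hne' : i ≠ i' := fun h => hne (by rw [h])
  obtain ⟨s, his, his'⟩ := Set.powersetCard.exists_mem_notMem (n := n) (α := Fin m)
    (Nat.one_le_iff_ne_zero.2 hn) (by simpa using hnm) hne'
  let J := Set.powersetCard.ofFinEmbEquiv.symm s
  have h1 := (H.isRoot_charpoly_solutionOfSubset J i).2
    ((Set.powersetCard.mem_range_ofFinEmbEquiv_symm_iff_mem s i).2 his)
  have h2 := Matrix.charpoly_map (solutionOfSubset ev u J) (g : Ω →+* Ω)
  have h3 : (solutionOfSubset ev u J).charpoly.IsRoot (ev i') := by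
    have h4 := h1.map (f := (g : Ω →+* Ω))
    rw [← h2] at h4
    rw [hi']
    have h5 : (solutionOfSubset ev u J).map (g : Ω →+* Ω) = solutionOfSubset ev u J :=
      hg _ (H.solutionOfSubset_mem J)
    rw [h5] at h4
    exact h4
  exact his' ((Set.powersetCard.mem_range_ofFinEmbEquiv_symm_iff_mem s i').1
    ((H.isRoot_charpoly_solutionOfSubset J i').1 h3))

theorem adjoin_entries_eq [IsAlgClosed Ω] [IsGalois K Ω] (H : IsGenericEigensystem A ev u)
    (hn : n ≠ 0) (hnm : n < m) :
    IntermediateField.adjoin K {a : Ω | ∃ X ∈ unilateralSolutions A Ω, ∃ i j, X i j = a} =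
      IntermediateField.adjoin K ((pencilDet A).rootSet Ω) := by
  apply le_antisymm
  · rw [IntermediateField.adjoin_le_iff]
    rintro _ ⟨X₀, hX, i, j, rfl⟩
    refine IntermediateField.mem_of_forall_algEquiv fun g hg => ?_
    refine congrFun (congrFun (H.map_algEquiv_eq_self (fun i => hg _ ?_) hX) i) j
    exact IntermediateField.subset_adjoin _ _ (H.range_eq ▸ Set.mem_range_self i)
  · rw [IntermediateField.adjoin_le_iff, ← H.range_eq]
    rintro _ ⟨i, rfl⟩
    refine IntermediateField.mem_of_forall_algEquiv fun g hg => ?_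
    refine H.algEquiv_apply_eq_self hn hnm (fun X₀ hX => ?_) i
    ext a b
    exact hg _ (IntermediateField.subset_adjoin _ _ ⟨X₀, hX, a, b, rfl⟩)

end IsGenericEigensystem

end GaloisAction

/-! ### Cubic and quartic equations by radicals -/

section Radicals

variable {K : Type*} [Field K] {Ω : Type*} [Field Ω] [Algebra K Ω] [CharZero Ω]
  {L : IntermediateField K Ω}

theorem IntermediateField.mem_of_add_mem_of_mul_mem (hL : ∀ x : Ω, x ^ 2 ∈ L → x ∈ L) {x y : Ω}
    (hadd : x + y ∈ L) (hmul : x * y ∈ L) : x ∈ L := by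
  have h1 : (x - y) ^ 2 ∈ L := by
    have : (x - y) ^ 2 = (x + y) ^ 2 - 4 * (x * y) := by ring
    rw [this]
    exact sub_mem (pow_mem hadd 2) (mul_mem (ofNat_mem L 4) hmul)
  have h2 : x = ((x + y) + (x - y)) / 2 := by ring
  rw [h2]
  exact div_mem (add_mem hadd (hL _ h1)) (ofNat_mem L 2)

/-- Cardano's formula: a field closed under square and cube roots contains the roots of the cubic
polynomials over it. -/
theorem IntermediateField.mem_of_cubic [IsAlgClosed Ω] (hL2 : ∀ x : Ω, x ^ 2 ∈ L → x ∈ L)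
    (hL3 : ∀ x : Ω, x ^ 3 ∈ L → x ∈ L) {x y z : Ω} (h1 : x + y + z ∈ L)
    (h2 : x * y + y * z + z * x ∈ L) (h3 : x * y * z ∈ L) : x ∈ L := by
  obtain ⟨w, hw⟩ : ∃ w : Ω, w ^ 2 + w + 1 = 0 := by
    obtain ⟨s, hs⟩ := IsAlgClosed.exists_pow_nat_eq (-3 : Ω) (n := 2) two_pos
    exact ⟨(-1 + s) / 2, by field_simp; linear_combination hs⟩
  have hw3 : w ^ 3 = 1 := by linear_combination (w - 1) * hw
  have hwL : w ∈ L := hL3 _ (by rw [hw3]; exact one_mem L)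
  -- Lagrange resolvents for a primitive cube root of unity w: the sum and product of u³ and v³ are
  -- symmetric in x, y, z, so a square root and cube roots recover u and v.
  set u := x + w * y + w ^ 2 * z with hu
  set v := x + w ^ 2 * y + w * z with hv
  have huv : u * v = (x + y + z) ^ 2 - 3 * (x * y + y * z + z * x) := by
    rw [hu, hv]
    linear_combination (w ^ 2 * y * z - w * y * z + x * y + x * z + y ^ 2 * (w - 1) + z ^ 2 * (w - 1)
      + y * z) * hw
  have hsum : u ^ 3 + v ^ 3 = 2 * (x + y + z) ^ 3 - 9 * (x + y + z) * (x * y + y * z + z * x)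
      + 27 * (x * y * z) := by
    have hadd : u + v = 2 * x - y - z := by
      rw [hu, hv]; linear_combination (y + z) * hw
    have h4 : u ^ 3 + v ^ 3 = (u + v) ^ 3 - 3 * (u * v) * (u + v) := by ring
    rw [h4, hadd, huv]
    ring
  have h3L : (3 : Ω) ∈ L := ofNat_mem L 3
  have huvL : u * v ∈ L := by
    rw [huv]
    exact sub_mem (pow_mem h1 2) (mul_mem h3L h2)
  have hsumL : u ^ 3 + v ^ 3 ∈ L := by
    rw [hsum]
    exact add_mem (sub_mem (mul_mem (ofNat_mem L 2) (pow_mem h1 3))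
      (mul_mem (mul_mem (ofNat_mem L 9) h1) h2)) (mul_mem (ofNat_mem L 27) h3)
  have hprodL : u ^ 3 * v ^ 3 ∈ L := by
    rw [← mul_pow]
    exact pow_mem huvL 3
  have huL : u ∈ L := hL3 _ (mem_of_add_mem_of_mul_mem hL2 hsumL hprodL)
  have hvL : v ∈ L := hL3 _ (mem_of_add_mem_of_mul_mem hL2 (by rwa [add_comm])
    (by rwa [mul_comm] at hprodL))
  have hx : x = ((x + y + z) + u + v) / 3 := by
    rw [hu, hv]
    field_simp
    linear_combination (-y - z) * hw
  rw [hx]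
  exact div_mem (add_mem (add_mem h1 huL) hvL) h3L

/-- Ferrari's formula: a field closed under square and cube roots contains the roots of the quartic
polynomials over it. -/
theorem IntermediateField.mem_of_quartic [IsAlgClosed Ω] (hL2 : ∀ x : Ω, x ^ 2 ∈ L → x ∈ L)
    (hL3 : ∀ x : Ω, x ^ 3 ∈ L → x ∈ L) {a b c d : Ω} (h1 : a + b + c + d ∈ L)
    (h2 : a * b + a * c + a * d + b * c + b * d + c * d ∈ L)
    (h3 : a * b * c + a * b * d + a * c * d + b * c * d ∈ L) (h4 : a * b * c * d ∈ L) : a ∈ L := by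
  set e1 := a + b + c + d with he1
  set e2 := a * b + a * c + a * d + b * c + b * d + c * d with he2
  set e3 := a * b * c + a * b * d + a * c * d + b * c * d with he3
  set e4 := a * b * c * d with he4
  -- A root of the resolvent cubic. It splits the quartic: ab and cd have sum θ and product e4, then
  -- a + b and c + d have sum e1 and product e2 - θ.
  have hθ : a * b + c * d ∈ L := by
    refine mem_of_cubic hL2 hL3 (y := a * c + b * d) (z := a * d + b * c) ?_ ?_ ?_
    · convert h2 using 1
      rw [he2]; ring
    · have : (a * b + c * d) * (a * c + b * d) + (a * c + b * d) * (a * d + b * c)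
          + (a * d + b * c) * (a * b + c * d) = e1 * e3 - 4 * e4 := by
        rw [he1, he3, he4]; ring
      rw [this]
      exact sub_mem (mul_mem h1 h3) (mul_mem (ofNat_mem L 4) h4)
    · have : (a * b + c * d) * (a * c + b * d) * (a * d + b * c) =
          e3 ^ 2 + e1 ^ 2 * e4 - 4 * e2 * e4 := by
        rw [he1, he2, he3, he4]; ring
      rw [this]
      exact sub_mem (add_mem (pow_mem h3 2) (mul_mem (pow_mem h1 2) h4))
        (mul_mem (mul_mem (ofNat_mem L 4) h2) h4)
  have hab : a * b ∈ L := by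
    refine mem_of_add_mem_of_mul_mem hL2 hθ ?_
    convert h4 using 1
    rw [he4]; ring
  refine mem_of_add_mem_of_mul_mem hL2 (y := b) ?_ hab
  refine mem_of_add_mem_of_mul_mem hL2 (y := c + d) ?_ ?_
  · convert h1 using 1
    rw [he1]; ring
  · have : (a + b) * (c + d) = e2 - (a * b + c * d) := by rw [he2]; ring
    rw [this]
    exact sub_mem h2 hθ

theorem coeff_quartic {R : Type*} [CommRing R] (a b c d : R) :
    (X ^ 4 + C a * X ^ 3 + C b * X ^ 2 + C c * X + C d).coeff 3 = a ∧
    (X ^ 4 + C a * X ^ 3 + C b * X ^ 2 + C c * X + C d).coeff 2 = b ∧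
    (X ^ 4 + C a * X ^ 3 + C b * X ^ 2 + C c * X + C d).coeff 1 = c ∧
    (X ^ 4 + C a * X ^ 3 + C b * X ^ 2 + C c * X + C d).coeff 0 = d := by
  simp [coeff_X, coeff_C, coeff_X_pow]

theorem mem_solvableByRad_of_quartic [IsAlgClosed Ω] {p : K[X]}
    {c : K} (hc : c ≠ 0) {ev : Fin 4 → Ω}
    (hp : p.map (algebraMap K Ω) = C (algebraMap K Ω c) * ∏ i, (X - C (ev i))) (i : Fin 4) :
    ev i ∈ solvableByRad K Ω := by
  have hc' : algebraMap K Ω c ≠ 0 := by simpa using hc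
  have key : ∀ a b e f : Ω, (X - C a) * (X - C b) * (X - C e) * (X - C f) =
      ∏ i, (X - C (ev i)) → a ∈ solvableByRad K Ω := by
    intro a b e f h
    rw [← h] at hp
    have hexp : (X - C a) * (X - C b) * (X - C e) * (X - C f) = X ^ 4 + C (-(a + b + e + f)) * X ^ 3
        + C (a * b + a * e + a * f + b * e + b * f + e * f) * X ^ 2
        + C (-(a * b * e + a * b * f + a * e * f + b * e * f)) * X + C (a * b * e * f) := by
      simp only [map_add, map_mul, map_neg]; ring
    rw [hexp] at hp
    have hcoeff : ∀ j, algebraMap K Ω (p.coeff j / c) = (X ^ 4 + C (-(a + b + e + f)) * X ^ 3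
        + C (a * b + a * e + a * f + b * e + b * f + e * f) * X ^ 2
        + C (-(a * b * e + a * b * f + a * e * f + b * e * f)) * X + C (a * b * e * f)).coeff j := by
      intro j
      rw [map_div₀, ← coeff_map, hp, coeff_C_mul, mul_div_cancel_left₀ _ hc']
    have hmem : ∀ x : K, algebraMap K Ω x ∈ solvableByRad K Ω := fun x =>
      IntermediateField.algebraMap_mem _ x
    refine IntermediateField.mem_of_quartic (b := b) (c := e) (d := f)
      (fun x hx => solvableByRad.rad_mem two_ne_zero hx)
      (fun x hx => solvableByRad.rad_mem three_ne_zero hx) ?_ ?_ ?_ ?_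
    · have h := neg_mem (hmem (p.coeff 3 / c))
      rwa [hcoeff, (coeff_quartic _ _ _ _).1, neg_neg] at h
    · have h := hmem (p.coeff 2 / c)
      rwa [hcoeff, (coeff_quartic _ _ _ _).2.1] at h
    · have h := neg_mem (hmem (p.coeff 1 / c))
      rwa [hcoeff, (coeff_quartic _ _ _ _).2.2.1, neg_neg] at h
    · have h := hmem (p.coeff 0 / c)
      rwa [hcoeff, (coeff_quartic _ _ _ _).2.2.2] at h
  simp only [Fin.prod_univ_four] at key
  fin_cases i
  · exact key (ev 0) (ev 1) (ev 2) (ev 3) (by ring)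
  · exact key (ev 1) (ev 0) (ev 2) (ev 3) (by ring)
  · exact key (ev 2) (ev 1) (ev 0) (ev 3) (by ring)
  · exact key (ev 3) (ev 1) (ev 2) (ev 0) (by ring)

end Radicals

/-! ### The obstruction to solvability -/

section Solvability

variable {K : Type*} [Field K] {Ω : Type*} [Field Ω] [Algebra K Ω]

theorem notMem_solvableByRad {p : K[X]} {m : ℕ} (hm : 5 ≤ m) (hirr : Irreducible p)
    (hGal : Nonempty (p.Gal ≃* Equiv.Perm (Fin m))) {x : Ω} (hx : aeval x p = 0) :
    x ∉ solvableByRad K Ω := by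
  intro h
  obtain ⟨e⟩ := hGal
  have h1 : Group.IsSolvable p.Gal := isSolvable_gal_of_irreducible h hirr hx
  have h2 : Group.IsSolvable (Equiv.Perm (Fin m)) :=
    Group.isSolvable_of_surjective (f := e.toMonoidHom) e.surjective
  exact Equiv.Perm.not_isSolvable (Fin m) (by simpa using hm) h2

end Solvability

/-- The elements computable by radicals form an intermediate field, so only the field generated by
the entries matters. -/
theorem isSolvableEquation_iff_rootSet {K Ω : Type*} [Field K] [Field Ω] [Algebra K Ω] {n : ℕ}
    {S : Set (Matrix (Fin n) (Fin n) Ω)} (hfin : S.Finite) (hne : S.Nonempty) {T : Set Ω}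
    (hadj : IntermediateField.adjoin K {a : Ω | ∃ X ∈ S, ∃ i j, X i j = a} =
      IntermediateField.adjoin K T) :
    IsSolvableEquation K S ↔ T ⊆ solvableByRad K Ω := by
  rw [← IntermediateField.adjoin_le_iff, ← hadj, IntermediateField.adjoin_le_iff]
  refine ⟨fun h => ?_, fun h => ⟨hfin, hne, fun X hX i j => h ⟨X, hX, i, j, rfl⟩⟩⟩
  rintro _ ⟨X, hX, i, j, rfl⟩
  exact h.2.2 X hX i j

end

/-! ### Proof of the main theorem -/

theorem mainTheorem1 {n k : ℕ} (hn : 2 ≤ n) (hk : 2 ≤ k)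
    {K : Type*} [Field K] [CharZero K]
    (A : Fin (k + 1) → Matrix (Fin n) (Fin n) K)
    (hA : AreGenericMatrices A)
    (hK : IntermediateField.adjoin ℚ (Set.range (matrixEntries A)) = ⊤)
    {Ω : Type*} [Field Ω] [Algebra K Ω] [IsAlgClosure K Ω] :
    -- exactly `C(kn, n)` solutions, all of them simple
    (unilateralSolutions A Ω).Finite ∧
    (unilateralSolutions A Ω).ncard = (k * n).choose n ∧
    (∀ X ∈ unilateralSolutions A Ω, IsSimpleSolution A X) ∧
    -- `φ` has degree `kn`, has `kn` distinct roots, and its Galois group over `K` is `S_{kn}`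
    (pencilDet A).natDegree = k * n ∧
    ((pencilDet A).rootSet Ω).ncard = k * n ∧
    Nonempty ((pencilDet A).Gal ≃* Equiv.Perm (Fin (k * n))) ∧
    -- the solutions are the matrices `X_J`
    (∀ ev : Fin (k * n) → Ω, Function.Injective ev →
      Set.range ev = (pencilDet A).rootSet Ω →
      ∀ u : Fin (k * n) → Fin n → Ω,
        (∀ i, u i ≠ 0 ∧ (matrixPencil A (ev i)).mulVec (u i) = 0) →
        (∀ J : Fin n ↪o Fin (k * n), IsUnit (eigenvectorMatrix u J).det) ∧
        Set.BijOn (solutionOfSubset ev u) Set.univ (unilateralSolutions A Ω)) ∧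
    -- `K((λ_i)_i)` is the smallest extension of `K` containing the entries of all solutions
    IsLeast {L : IntermediateField K Ω | ∀ X ∈ unilateralSolutions A Ω, ∀ i j, X i j ∈ L}
      (IntermediateField.adjoin K ((pencilDet A).rootSet Ω)) ∧
    -- solvability by radicals
    (IsSolvableEquation K (unilateralSolutions A Ω) ↔ n = 2 ∧ k = 2) ∧
    -- solvability complexity
    HasSolvabilityComplexity K (unilateralSolutions A Ω) ((k * n).choose n)
      (Equiv.Perm (Fin (k * n))) := by
  have : CharZero Ω := charZero_of_injective_algebraMap (algebraMap K Ω).injective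
  have : IsAlgClosed Ω := IsAlgClosure.isAlgClosed K
  have : Algebra.IsAlgebraic K Ω := IsAlgClosure.isAlgebraic
  have : IsGalois K Ω := IsAlgClosure.isGalois K Ω
  have hB := isTranscendenceBasis_matrixEntries (Ω := Ω) hA hK
  have hdeg := natDegree_pencilDet (det_ne_zero_of_algebraicIndependent hA (Fin.last k))
  have hk0 : k ≠ 0 := by omega
  obtain ⟨d, rfl⟩ : ∃ d, n = d + 1 := ⟨n - 1, by omega⟩
  obtain ⟨e, v, H⟩ := exists_isGenericEigensystem hk0 hB hdeg
  have hlt : d + 1 < k * (d + 1) := by nlinarith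
  have hadj := H.adjoin_entries_eq (Nat.succ_ne_zero d) hlt
  have hperm := exists_algEquiv_permuting_roots hk0 hK hB hdeg H.injective H.range_eq
  have hGal := Polynomial.Gal.nonempty_mulEquiv_perm H.injective H.range_eq hperm
  have hfin := H.unilateralSolutions_finite
  have hncard := H.ncard_unilateralSolutions
  have hne : (unilateralSolutions A Ω).Nonempty := by
    rw [← Set.ncard_pos hfin, hncard]
    exact Nat.choose_pos hlt.le
  have hroots := pencilDet_eq_C_mul_prod hk0 hB hdeg H.injective H.range_eq
  rw [← pencilDet_map_eq_det] at hroots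
  have h0 : pencilDet A ≠ 0 := fun h => H.separable.ne_zero (by rw [h, Polynomial.map_zero])
  refine ⟨hfin, hncard, fun X hX => H.isSimpleSolution hX, hdeg, ?_, hGal, ?_, ?_, ?_, ?_⟩
  · rw [← H.range_eq, ← Set.image_univ, Set.ncard_image_of_injective _ H.injective]
    simp
  · intro ev hev hrange u hu
    have H' := isGenericEigensystem hk0 hB hdeg hev hrange (fun i => (hu i).1) fun i => (hu i).2
    exact ⟨H'.isUnit_det, H'.bijOn⟩
  · refine ⟨fun X hX i j => ?_, fun L hL => ?_⟩
    · rw [← hadj]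
      exact IntermediateField.subset_adjoin _ _ ⟨X, hX, i, j, rfl⟩
    · rw [← hadj, IntermediateField.adjoin_le_iff]
      rintro _ ⟨X, hX, i, j, rfl⟩
      exact hL X hX i j
  · rw [isSolvableEquation_iff_rootSet hfin hne hadj, ← H.range_eq]
    constructor
    · intro h
      by_contra hnk
      -- As both factors are at least 2, a product of at most 4 leaves only n = k = 2.
      have h5 : 5 ≤ k * (d + 1) := by
        by_contra h4
        apply hnk
        constructor <;> nlinarith
      have hirr := Polynomial.irreducible_of_forall_perm (by omega) hdeg H.injective H.range_eq hperm
      refine notMem_solvableByRad h5 hirr hGal ?_ (h (Set.mem_range_self ⟨0, by omega⟩))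
      exact aeval_eq_zero_of_mem_rootSet (H.range_eq ▸ Set.mem_range_self _)
    · rintro ⟨hd, rfl⟩
      obtain rfl : d = 1 := by omega
      rintro _ ⟨i, rfl⟩
      exact mem_solvableByRad_of_quartic (leadingCoeff_ne_zero.2 h0) hroots i
  · exact ⟨hfin, hncard, pencilDet A, h0, IsAlgClosed.splits _, hadj, hGal⟩
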